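/- Let $\mathcal G$ be a finite metric graph with finite sets of internal edges $\mathcal I=\mathcal I_+\,\dot\cup\,\mathcal I_-$ and external edges $\mathcal E=\mathcal E_+\,\dot\cup\,\mathcal E_-$; an internal edge $i$ is identified with $I_i=[0,a_i]$, $a_i>0$, an external edge $e$ with $I_e=[0,\infty)$. Edges in $\mathcal E_\pm\cup\mathcal I_\pm$ are called positive/negative. Put $n=2|\mathcal I_+|+|\mathcal E_+|$, $m=2|\mathcal I_-|+|\mathcal E_-|$ and $\mathcal H=\bigoplus_j L^2(I_j)$. Let $\mathcal D=\bigoplus_j\mathcal D_j$, where $\mathcal D_j$ is the set of $\psi_j\in L^2(I_j)$ such that $\psi_j,\psi_j'$ are (locally) absolutely continuous on $I_j$ and $\psi_j''\in L^2(I_j)$, and let $\mathcal D^0\subset\mathcal D$ be the subspace of those $\psi$ for which $\psi_j$ and $\psi_j'$ vanish at $0$ for all edges $j$, and at $a_j$ for all internal edges $j$. Let $\tau$ act as $-\frac{d^2}{dx^2}$ on positive and as $+\frac{d^2}{dx^2}$ on negative edges, and let $T^{\min}=(\tau,\mathcal D^0)$ in $\mathcal H$. Let $\mathcal K_\pm=\mathbb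 C^{|\mathcal E_\pm|}\oplus\mathbb C^{|\mathcal I_\pm|}\oplus\mathbb C^{|\mathcal I_\pm|}$ and $\mathcal K=\mathcal K_+\oplus\mathcal K_-$. For $\psi\in\mathcal D$ let $\underline\psi=(\underline\psi_+,\underline\psi_-)$, $\underline{\psi}'=(\underline\psi'_+,\underline\psi'_-)\in\mathcal K$ with $$\underline\psi_\pm=\big(\{\psi_j(0)\}_{j\in\mathcal E_\pm},\{\psi_j(0)\}_{j\in\mathcal I_\pm},\{\psi_j(a_j)\}_{j\in\mathcal I_\pm}\big),\quad \underline\psi'_\pm=\big(\{\psi_j'(0)\}_{j\in\mathcal E_\pm},\{\psi_j'(0)\}_{j\in\mathcal I_\pm},\{-\psi_j'(a_j)\}_{j\in\mathcal I_\pm}\big),$$ and $[\psi]=\underline\psi\oplus\underline\psi'\in\mathcal K^2=\mathcal K\oplus\mathcal K$. Let $J_{n,m}=\begin{bmatrix}\mathbb 1_n&0\\0&-\mathbb 1_m\end{bmatrix}$ on $\mathcal K=\mathcal K_+\oplus\mathcal K_-$, and let $$j_{(\mathcal G_+,\mathcal G_-)}(\xi,\eta)=\Big\langle \xi,\begin{bmatrix}0&-J_{n,m}\\J_{n,m}&0\end{bmatrix}\eta\Big\rangle_{\mathcal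 K^2}.$$ A subspace $\mathcal M\subset\mathcal K^2$ is maximal isotropic if $j_{(\mathcal G_+,\mathcal G_-)}$ vanishes on $\mathcal M\times\mathcal M$ and no strictly larger subspace has this property. For linear maps $A,B$ in $\mathcal K$ let $(A,B):\mathcal K^2\to\mathcal K$, $(A,B)(\eta_1\oplus\eta_2)=A\eta_1+B\eta_2$, let $\mathcal M(A,B)=\ker(A,B)$, and let $T(A,B)=(\tau,\{\psi\in\mathcal D: A\underline\psi+B\underline\psi'=0\})$. Consider the conditions (1) $\operatorname{rank}(A,B)=n+m$, and (2) $BJ_{n,m}A^*=AJ_{n,m}B^*$. Theorem. (a) The map $\mathcal M\mapsto(\tau,\{\psi\in\mathcal D:[\psi]\in\mathcal M\})$ is a bijection from the set of maximal isotropic subspaces of $\mathcal K^2$ onto the set of self-adjoint extensions of $T^{\min}$ in $\mathcal H$. (b) A subspace $\mathcal M\subset\mathcal K^2$ is maximal isotropic if and only if $\mathcal M=\mathcal M(A,B)$ for some linear maps $A,B$ in $\mathcal K$ satisfying (1) and (2). (c) An operator in $\mathcal H$ is a self-adjoint extension of $T^{\min}$ if and only if it equals $T(A,B)$ for some linear maps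 $A,B$ in $\mathcal K$ satisfying (1) and (2). -/

import Mathlib

open MeasureTheory Set
open scoped Matrix

noncomputable section

/-- A finite metric graph with positive and negative edges.  `V` is the set of vertices, `Ep`, `Em`
are the positive and negative external edges, `Ip`, `Im` the positive and negative internal edges,
so that `Ep ⊕ Em` is the set of external and `Ip ⊕ Im` the set of internal edges.
An internal edge has an ordered pair of (initial, terminal) vertices and a length `> 0`,
an external edge has one (initial) vertex. -/
structure SignedMetricGraph (V Ep Em Ip Im : Type*) where
  bdExt : Ep ⊕ Em → V
  bdInt : Ip ⊕ Im → V × V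
  len : Ip ⊕ Im → ℝ
  len_pos : ∀ i, 0 < len i

namespace SignedMetricGraph

/-- All edges: external and internal ones. -/
abbrev Edge (Ep Em Ip Im : Type*) : Type _ := (Ep ⊕ Em) ⊕ (Ip ⊕ Im)

/-- The sign of an edge. -/
def sign {Ep Em Ip Im : Type*} : Edge Ep Em Ip Im → ℂ
  | .inl (.inl _) => 1
  | .inl (.inr _) => -1
  | .inr (.inl _) => 1
  | .inr (.inr _) => -1

/-- Index set of the boundary values for one sign: `ψ_j(0)` for external edges, `ψ_j(0)` for
internal edges, `ψ_j(a_j)` for internal edges. -/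
abbrev HalfIndex (E I : Type*) : Type _ := E ⊕ (I ⊕ I)

/-- Index set of the boundary values, first those on positive, then those on negative edges. -/
abbrev Index (Ep Em Ip Im : Type*) : Type _ := HalfIndex Ep Ip ⊕ HalfIndex Em Im

/-- The space `𝒦 = 𝒦₊ ⊕ 𝒦₋` of boundary values. -/
abbrev K (Ep Em Ip Im : Type*) : Type _ := EuclideanSpace ℂ (Index Ep Em Ip Im)

/-- The space `𝒦² = 𝒦 ⊕ 𝒦`. -/
abbrev K2 (Ep Em Ip Im : Type*) : Type _ :=
  EuclideanSpace ℂ (Index Ep Em Ip Im ⊕ Index Ep Em Ip Im)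

section FiniteDimensional

variable (Ep Em Ip Im : Type*) [Fintype Ep] [Fintype Em] [Fintype Ip] [Fintype Im]
  [DecidableEq Ep] [DecidableEq Em] [DecidableEq Ip] [DecidableEq Im]

/-- `J_{n,m} = diag(1_n, -1_m)` on `𝒦 = 𝒦₊ ⊕ 𝒦₋`. -/
def Jnm : Matrix (Index Ep Em Ip Im) (Index Ep Em Ip Im) ℂ :=
  Matrix.fromBlocks 1 0 0 (-1)

/-- The matrix of the Hermitian symplectic form on `𝒦² = 𝒦 ⊕ 𝒦`. -/
def symplecticMatrix :
    Matrix (Index Ep Em Ip Im ⊕ Index Ep Em Ip Im) (Index Ep Em Ip Im ⊕ Index Ep Em Ip Im) ℂ :=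
  Matrix.fromBlocks 0 (Matrix.fromBlocks (-1) 0 0 1) (Matrix.fromBlocks 1 0 0 (-1)) 0

variable {Ep Em Ip Im}

/-- The Hermitian symplectic form on `𝒦²` (conjugate linear in the first argument). -/
def symplecticForm (ξ η : K2 Ep Em Ip Im) : ℂ :=
  inner ℂ ξ (WithLp.toLp 2 (symplecticMatrix Ep Em Ip Im *ᵥ η.ofLp))

/-- Isotropic subspaces of `𝒦²`. -/
def IsIsotropic (M : Submodule ℂ (K2 Ep Em Ip Im)) : Prop :=
  ∀ ξ ∈ M, ∀ η ∈ M, symplecticForm ξ η = 0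

/-- Maximal isotropic subspaces of `𝒦²`. -/
def IsMaximalIsotropic (M : Submodule ℂ (K2 Ep Em Ip Im)) : Prop :=
  Maximal IsIsotropic M

/-- `ℳ(A, B) = ker (A, B)`. -/
def kerAB (A B : Matrix (Index Ep Em Ip Im) (Index Ep Em Ip Im) ℂ) :
    Submodule ℂ (K2 Ep Em Ip Im) :=
  LinearMap.ker ((Matrix.fromCols A B).mulVecLin ∘ₗ (WithLp.linearEquiv 2 ℂ _).toLinearMap)

/-- The conditions on `A`, `B`: `(A, B)` has rank `n + m`, where `n = 2|I₊| + |E₊|` and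
`m = 2|I₋| + |E₋|`, and `B J A* = A J B*`. -/
def BoundaryCondition (A B : Matrix (Index Ep Em Ip Im) (Index Ep Em Ip Im) ℂ) : Prop :=
  (Matrix.fromCols A B).rank =
      (2 * Fintype.card Ip + Fintype.card Ep) + (2 * Fintype.card Im + Fintype.card Em) ∧
    B * Jnm Ep Em Ip Im * A.conjTranspose = A * Jnm Ep Em Ip Im * B.conjTranspose

end FiniteDimensional

/-- `f` and `g` represent a function on the interval `I` and its derivative: `u = f` almost
everywhere, `f' = g` on `I` (one-sided at end points), `f` and `g` are absolutely continuous
(on every compact subinterval of `I`), and the almost everywhere derivative of `g` is the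
square integrable function `w`. -/
structure IsRep (I : Set ℝ) (u w : Lp ℂ 2 (volume.restrict I)) (f g : ℝ → ℂ) : Prop where
  ae_eq : ∀ᵐ x ∂(volume.restrict I), u x = f x
  ac : ∀ a ∈ I, ∀ b ∈ I, AbsolutelyContinuousOnInterval f a b
  deriv : ∀ x ∈ I, HasDerivWithinAt f (g x) I x
  ac_deriv : ∀ a ∈ I, ∀ b ∈ I, AbsolutelyContinuousOnInterval g a b
  deriv2 : ∀ᵐ x ∂(volume.restrict I), HasDerivWithinAt g (w x) I x

theorem IsRep.zero (I : Set ℝ) : IsRep I 0 0 (fun _ => 0) (fun _ => 0) where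
  ae_eq := Lp.coeFn_zero ℂ 2 (volume.restrict I)
  ac _ _ _ _ := (LipschitzWith.const (0 : ℂ)).lipschitzOnWith.absolutelyContinuousOnInterval
  deriv x _ := hasDerivWithinAt_const x I 0
  ac_deriv _ _ _ _ := (LipschitzWith.const (0 : ℂ)).lipschitzOnWith.absolutelyContinuousOnInterval
  deriv2 := by
    filter_upwards [Lp.coeFn_zero ℂ 2 (volume.restrict I)] with x hx
    rw [hx]
    exact hasDerivWithinAt_const x I 0

theorem IsRep.add {I : Set ℝ} {u w u' w' : Lp ℂ 2 (volume.restrict I)} {f g f' g' : ℝ → ℂ}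
    (h : IsRep I u w f g) (h' : IsRep I u' w' f' g') :
    IsRep I (u + u') (w + w') (f + f') (g + g') where
  ae_eq := by
    filter_upwards [Lp.coeFn_add u u', h.ae_eq, h'.ae_eq] with x hx h1 h2
    rw [hx, Pi.add_apply, Pi.add_apply, h1, h2]
  ac a ha b hb := (h.ac a ha b hb).add (h'.ac a ha b hb)
  deriv x hx := (h.deriv x hx).add (h'.deriv x hx)
  ac_deriv a ha b hb := (h.ac_deriv a ha b hb).add (h'.ac_deriv a ha b hb)
  deriv2 := by
    filter_upwards [Lp.coeFn_add w w', h.deriv2, h'.deriv2] with x hx h1 h2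
    rw [hx]
    exact h1.add h2

theorem IsRep.smul {I : Set ℝ} {u w : Lp ℂ 2 (volume.restrict I)} {f g : ℝ → ℂ} (c : ℂ)
    (h : IsRep I u w f g) : IsRep I (c • u) (c • w) (c • f) (c • g) where
  ae_eq := by
    filter_upwards [Lp.coeFn_smul c u, h.ae_eq] with x hx h1
    rw [hx, Pi.smul_apply, Pi.smul_apply, h1]
  ac a ha b hb := (h.ac a ha b hb).const_smul c
  deriv x hx := (h.deriv x hx).const_smul c
  ac_deriv a ha b hb := (h.ac_deriv a ha b hb).const_smul c
  deriv2 := by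
    filter_upwards [Lp.coeFn_smul c w, h.deriv2] with x hx h1
    rw [hx]
    exact h1.const_smul c

theorem IsRep.unique {I : Set ℝ} (hI : I ⊆ closure (interior I)) (hU : UniqueDiffOn ℝ I)
    (hm : MeasurableSet I) {u w w' : Lp ℂ 2 (volume.restrict I)} {f g f' g' : ℝ → ℂ}
    (h : IsRep I u w f g) (h' : IsRep I u w' f' g') : EqOn f f' I ∧ EqOn g g' I ∧ w = w' := by
  have e1 : EqOn f f' I := by
    apply Measure.eqOn_of_ae_eq (μ := volume) _ _ _ hI
    · filter_upwards [h.ae_eq, h'.ae_eq] with x h1 h2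
      rw [← h1, ← h2]
    · exact fun x hx => (h.deriv x hx).continuousWithinAt
    · exact fun x hx => (h'.deriv x hx).continuousWithinAt
  have e2 : EqOn g g' I := fun x hx =>
    (hU x hx).eq_deriv I (h.deriv x hx) ((h'.deriv x hx).congr e1 (e1 hx))
  refine ⟨e1, e2, Lp.ext ?_⟩
  filter_upwards [h.deriv2, h'.deriv2, ae_restrict_mem hm] with x h1 h2 hx
  exact (hU x hx).eq_deriv I h1 (h2.congr e2 (e2 hx))

/-- The space `𝒟_j` for an edge with interval `I`. -/
def edgeD (I : Set ℝ) : Submodule ℂ (Lp ℂ 2 (volume.restrict I)) where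
  carrier := {u | ∃ w f g, IsRep I u w f g}
  zero_mem' := ⟨0, _, _, IsRep.zero I⟩
  add_mem' := by
    rintro u u' ⟨w, f, g, h⟩ ⟨w', f', g', h'⟩
    exact ⟨_, _, _, h.add h'⟩
  smul_mem' := by
    rintro c u ⟨w, f, g, h⟩
    exact ⟨_, _, _, h.smul c⟩

/-- The second derivative of an element of `𝒟_j`. -/
def edgeD_snd {I : Set ℝ} (u : edgeD I) : Lp ℂ 2 (volume.restrict I) := u.2.choose

/-- The continuously differentiable representative of an element of `𝒟_j` (meaningful on `I`). -/
def edgeD_rep {I : Set ℝ} (u : edgeD I) : ℝ → ℂ := u.2.choose_spec.choose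

/-- The continuous representative of the derivative (meaningful on `I`). -/
def edgeD_der {I : Set ℝ} (u : edgeD I) : ℝ → ℂ := u.2.choose_spec.choose_spec.choose

theorem edgeD_isRep {I : Set ℝ} (u : edgeD I) : IsRep I u (edgeD_snd u) (edgeD_rep u) (edgeD_der u) :=
  u.2.choose_spec.choose_spec.choose_spec

variable {V Ep Em Ip Im : Type*} (G : SignedMetricGraph V Ep Em Ip Im)

/-- The interval of an edge: `[0, ∞)` for external, `[0, a_i]` for internal edges. -/
def interval : Edge Ep Em Ip Im → Set ℝ
  | .inl _ => Ici 0
  | .inr i => Icc 0 (G.len i)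

theorem zero_mem (j : Edge Ep Em Ip Im) : (0 : ℝ) ∈ G.interval j := by
  cases j with
  | inl e => simp [interval]
  | inr i => simp [interval, (G.len_pos i).le]

theorem len_mem (i : Ip ⊕ Im) : G.len i ∈ G.interval (.inr i) := by
  simp [interval, (G.len_pos i).le]

theorem measurableSet_interval (j : Edge Ep Em Ip Im) : MeasurableSet (G.interval j) := by
  cases j with
  | inl e => exact measurableSet_Ici
  | inr i => exact measurableSet_Icc

theorem uniqueDiffOn_interval (j : Edge Ep Em Ip Im) : UniqueDiffOn ℝ (G.interval j) := by
  cases j with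
  | inl e => exact uniqueDiffOn_Ici 0
  | inr i => exact uniqueDiffOn_Icc (G.len_pos i)

theorem interval_subset (j : Edge Ep Em Ip Im) :
    G.interval j ⊆ closure (interior (G.interval j)) := by
  cases j with
  | inl e => simp [interval]
  | inr i => simp [interval, closure_Ioo (G.len_pos i).ne]

theorem IsRep.unique' {j : Edge Ep Em Ip Im} {u w w' : Lp ℂ 2 (volume.restrict (G.interval j))}
    {f g f' g' : ℝ → ℂ} (h : IsRep (G.interval j) u w f g) (h' : IsRep (G.interval j) u w' f' g') :
    EqOn f f' (G.interval j) ∧ EqOn g g' (G.interval j) ∧ w = w' :=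
  h.unique (G.interval_subset j) (G.uniqueDiffOn_interval j) (G.measurableSet_interval j) h'

/-- The value `u(x)`, `x ∈ I_j`, of an element of `𝒟_j`, as a linear functional. -/
def edgeValue (j : Edge Ep Em Ip Im) (x : ℝ) (hx : x ∈ G.interval j) :
    edgeD (G.interval j) →ₗ[ℂ] ℂ where
  toFun u := edgeD_rep u x
  map_add' u v := (IsRep.unique' G (edgeD_isRep (u + v)) ((edgeD_isRep u).add (edgeD_isRep v))).1 hx
  map_smul' c u := (IsRep.unique' G (edgeD_isRep (c • u)) ((edgeD_isRep u).smul c)).1 hx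

/-- The derivative `u'(x)`, `x ∈ I_j`, of an element of `𝒟_j`, as a linear functional. -/
def edgeDeriv (j : Edge Ep Em Ip Im) (x : ℝ) (hx : x ∈ G.interval j) :
    edgeD (G.interval j) →ₗ[ℂ] ℂ where
  toFun u := edgeD_der u x
  map_add' u v := (IsRep.unique' G (edgeD_isRep (u + v)) ((edgeD_isRep u).add (edgeD_isRep v))).2.1 hx
  map_smul' c u := (IsRep.unique' G (edgeD_isRep (c • u)) ((edgeD_isRep u).smul c)).2.1 hx

/-- The second derivative as a linear map `𝒟_j → L²(I_j)`. -/
def edgeSnd (j : Edge Ep Em Ip Im) :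
    edgeD (G.interval j) →ₗ[ℂ] Lp ℂ 2 (volume.restrict (G.interval j)) where
  toFun u := edgeD_snd u
  map_add' u v := (IsRep.unique' G (edgeD_isRep (u + v)) ((edgeD_isRep u).add (edgeD_isRep v))).2.2
  map_smul' c u := (IsRep.unique' G (edgeD_isRep (c • u)) ((edgeD_isRep u).smul c)).2.2

/-- The Hilbert space `ℋ = ⨁_j L²(I_j)`. -/
abbrev H : Type _ := PiLp 2 fun j : Edge Ep Em Ip Im => Lp ℂ 2 (volume.restrict (G.interval j))

section Operators

variable [Fintype Ep] [Fintype Em] [Fintype Ip] [Fintype Im]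

/-- The maximal domain `𝒟 = ⨁_j 𝒟_j`. -/
def D : Submodule ℂ G.H where
  carrier := {ψ | ∀ j, ψ j ∈ edgeD (G.interval j)}
  zero_mem' j := (edgeD (G.interval j)).zero_mem
  add_mem' h h' j := (edgeD (G.interval j)).add_mem (h j) (h' j)
  smul_mem' c _ h j := (edgeD (G.interval j)).smul_mem c (h j)

/-- The component `ψ_j ∈ 𝒟_j` of `ψ ∈ 𝒟`. -/
def comp (j : Edge Ep Em Ip Im) : G.D →ₗ[ℂ] edgeD (G.interval j) where
  toFun ψ := ⟨ψ.1 j, ψ.2 j⟩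
  map_add' _ _ := rfl
  map_smul' _ _ := rfl

/-- `ψ_j(x)` for `ψ ∈ 𝒟`, `x ∈ I_j`. -/
def value (j : Edge Ep Em Ip Im) (x : ℝ) (hx : x ∈ G.interval j) : G.D →ₗ[ℂ] ℂ :=
  G.edgeValue j x hx ∘ₗ G.comp j

/-- `ψ_j'(x)` for `ψ ∈ 𝒟`, `x ∈ I_j`. -/
def deriv (j : Edge Ep Em Ip Im) (x : ℝ) (hx : x ∈ G.interval j) : G.D →ₗ[ℂ] ℂ :=
  G.edgeDeriv j x hx ∘ₗ G.comp j

/-- `T^max = (τ, 𝒟)`, where `τ = -d²/dx²` on positive and `τ = +d²/dx²` on negative edges. -/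
def Tmax : G.H →ₗ.[ℂ] G.H where
  domain := G.D
  toFun := (WithLp.linearEquiv 2 ℂ _).symm.toLinearMap ∘ₗ
    LinearMap.pi fun j => (-sign j) • (G.edgeSnd j ∘ₗ G.comp j)

/-- The domain `𝒟⁰` of functions vanishing, with their derivatives, at all ends of edges. -/
def D0 : Submodule ℂ G.H where
  carrier := {ψ | ∃ h : ψ ∈ G.D,
    (∀ j, G.value j 0 (G.zero_mem j) ⟨ψ, h⟩ = 0 ∧ G.deriv j 0 (G.zero_mem j) ⟨ψ, h⟩ = 0) ∧
    (∀ i, G.value (.inr i) (G.len i) (G.len_mem i) ⟨ψ, h⟩ = 0 ∧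
      G.deriv (.inr i) (G.len i) (G.len_mem i) ⟨ψ, h⟩ = 0)}
  zero_mem' := ⟨G.D.zero_mem, fun _ => ⟨map_zero _, map_zero _⟩, fun _ => ⟨map_zero _, map_zero _⟩⟩
  add_mem' := by
    rintro ψ φ ⟨h, h1, h2⟩ ⟨k, k1, k2⟩
    exact ⟨G.D.add_mem h k,
      fun j => ⟨(LinearMap.ker _).add_mem (h1 j).1 (k1 j).1,
        (LinearMap.ker _).add_mem (h1 j).2 (k1 j).2⟩,
      fun i => ⟨(LinearMap.ker _).add_mem (h2 i).1 (k2 i).1,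
        (LinearMap.ker _).add_mem (h2 i).2 (k2 i).2⟩⟩
  smul_mem' := by
    rintro c ψ ⟨h, h1, h2⟩
    exact ⟨G.D.smul_mem c h,
      fun j => ⟨(LinearMap.ker _).smul_mem c (h1 j).1, (LinearMap.ker _).smul_mem c (h1 j).2⟩,
      fun i => ⟨(LinearMap.ker _).smul_mem c (h2 i).1, (LinearMap.ker _).smul_mem c (h2 i).2⟩⟩

/-- `T^min = (τ, 𝒟⁰)`. -/
def Tmin : G.H →ₗ.[ℂ] G.H := G.Tmax.domRestrict G.D0

/-- The vector `ψ̲` of boundary values. -/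
def trace : G.D →ₗ[ℂ] K Ep Em Ip Im :=
  (WithLp.linearEquiv 2 ℂ _).symm.toLinearMap ∘ₗ LinearMap.pi fun
    | .inl (.inl e) => G.value (.inl (.inl e)) 0 (G.zero_mem _)
    | .inl (.inr (.inl i)) => G.value (.inr (.inl i)) 0 (G.zero_mem _)
    | .inl (.inr (.inr i)) => G.value (.inr (.inl i)) (G.len (.inl i)) (G.len_mem _)
    | .inr (.inl e) => G.value (.inl (.inr e)) 0 (G.zero_mem _)
    | .inr (.inr (.inl i)) => G.value (.inr (.inr i)) 0 (G.zero_mem _)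
    | .inr (.inr (.inr i)) => G.value (.inr (.inr i)) (G.len (.inr i)) (G.len_mem _)

/-- The vector `ψ̲'` of inward boundary derivatives. -/
def traceDeriv : G.D →ₗ[ℂ] K Ep Em Ip Im :=
  (WithLp.linearEquiv 2 ℂ _).symm.toLinearMap ∘ₗ LinearMap.pi fun
    | .inl (.inl e) => G.deriv (.inl (.inl e)) 0 (G.zero_mem _)
    | .inl (.inr (.inl i)) => G.deriv (.inr (.inl i)) 0 (G.zero_mem _)
    | .inl (.inr (.inr i)) => -G.deriv (.inr (.inl i)) (G.len (.inl i)) (G.len_mem _)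
    | .inr (.inl e) => G.deriv (.inl (.inr e)) 0 (G.zero_mem _)
    | .inr (.inr (.inl i)) => G.deriv (.inr (.inr i)) 0 (G.zero_mem _)
    | .inr (.inr (.inr i)) => -G.deriv (.inr (.inr i)) (G.len (.inr i)) (G.len_mem _)

/-- The vector `[ψ] = ψ̲ ⊕ ψ̲'` in `𝒦²`. -/
def bv : G.D →ₗ[ℂ] K2 Ep Em Ip Im where
  toFun ψ := WithLp.toLp 2 (Sum.elim (G.trace ψ) (G.traceDeriv ψ))
  map_add' ψ φ := by ext (k | k) <;> simp
  map_smul' c ψ := by ext (k | k) <;> simp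

/-- The domain `{ψ ∈ 𝒟 | [ψ] ∈ ℳ}`. -/
def domOf (M : Submodule ℂ (K2 Ep Em Ip Im)) : Submodule ℂ G.H where
  carrier := {ψ | ∃ h : ψ ∈ G.D, G.bv ⟨ψ, h⟩ ∈ M}
  zero_mem' := ⟨G.D.zero_mem, (M.comap G.bv).zero_mem⟩
  add_mem' := by
    rintro ψ φ ⟨h, h1⟩ ⟨k, k1⟩
    exact ⟨G.D.add_mem h k, (M.comap G.bv).add_mem h1 k1⟩
  smul_mem' := by
    rintro c ψ ⟨h, h1⟩
    exact ⟨G.D.smul_mem c h, (M.comap G.bv).smul_mem c h1⟩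

/-- The operator `τ` with domain `{ψ ∈ 𝒟 | [ψ] ∈ ℳ}`. -/
def opOf (M : Submodule ℂ (K2 Ep Em Ip Im)) : G.H →ₗ.[ℂ] G.H := G.Tmax.domRestrict (G.domOf M)

/-- The linear map `ψ ↦ A ψ̲ + B ψ̲'`. -/
def abMap (A B : Matrix (Index Ep Em Ip Im) (Index Ep Em Ip Im) ℂ) :
    G.D →ₗ[ℂ] (Index Ep Em Ip Im → ℂ) where
  toFun ψ := A *ᵥ (G.trace ψ).ofLp + B *ᵥ (G.traceDeriv ψ).ofLp
  map_add' ψ φ := by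
    rw [map_add, map_add, WithLp.ofLp_add, WithLp.ofLp_add, Matrix.mulVec_add, Matrix.mulVec_add]
    abel
  map_smul' c ψ := by
    rw [map_smul, map_smul, WithLp.ofLp_smul, WithLp.ofLp_smul, Matrix.mulVec_smul,
      Matrix.mulVec_smul, RingHom.id_apply, smul_add]

/-- `Dom T(A, B) = {ψ ∈ 𝒟 | A ψ̲ + B ψ̲' = 0}`. -/
def domAB (A B : Matrix (Index Ep Em Ip Im) (Index Ep Em Ip Im) ℂ) : Submodule ℂ G.H where
  carrier := {ψ | ∃ h : ψ ∈ G.D, G.abMap A B ⟨ψ, h⟩ = 0}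
  zero_mem' := ⟨G.D.zero_mem, map_zero (G.abMap A B)⟩
  add_mem' := by
    rintro ψ φ ⟨h, h1⟩ ⟨k, k1⟩
    have e := map_add (G.abMap A B) ⟨ψ, h⟩ ⟨φ, k⟩
    rw [h1, k1, add_zero] at e
    exact ⟨G.D.add_mem h k, e⟩
  smul_mem' := by
    rintro c ψ ⟨h, h1⟩
    have e := map_smul (G.abMap A B) c ⟨ψ, h⟩
    rw [h1, smul_zero] at e
    exact ⟨G.D.smul_mem c h, e⟩

/-- `T(A, B) = (τ, Dom T(A, B))`. -/
def opAB (A B : Matrix (Index Ep Em Ip Im) (Index Ep Em Ip Im) ℂ) : G.H →ₗ.[ℂ] G.H :=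
  G.Tmax.domRestrict (G.domAB A B)

end Operators

end SignedMetricGraph

end

/-! Integration by parts turns the failure of symmetry of `Tmax` into the symplectic form of the
boundary values (`green`). Those values are arbitrary (`bv_surjective`) and vanish exactly on `D0`
(`mem_D0_iff`), so operators between `Tmin` and `Tmax` correspond to subspaces of 𝒦². The adjoint of
`Tmin` is contained in `Tmax` (`mem_D_of_forall_D0`), hence every self-adjoint extension lies in
that range, and the adjoint of the operator of M is the operator of the symplectic complement of M.
Self-adjointness therefore means that M equals its own complement.

That this is the same as maximal isotropy (`isMaximalIsotropic_iff`) depends on the balanced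
signature of the form: in the coordinates ξ₁ ± iJξ₂ it is a multiple of ‖·‖² − ‖·‖² on two copies of
𝒦, whatever the signs of the edges. A maximal isotropic M is then the graph of a unitary map of 𝒦,
and has dimension n + m.

For (b), write N = (A, B) and S for the matrix of the form. Condition (2) says N S N* = 0, that is,
range(S N*) ⊆ ker N; the rank condition makes the dimensions agree. Since ω(S N* x, η) = x* N η, the
complement of range(S N*) is ker N, so ker N is its own complement. Conversely, the rows of N may be
taken to be the functionals ω(b_k, ·) for a basis b of M. -/

namespace SignedMetricGraph

/-! ### Maximal isotropic subspaces of a form with balanced signature -/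

/-- Let the form `ω` be a multiple of a difference `⟪Up ξ, Up η⟫ - ⟪Um ξ, Um η⟫` of inner products,
where `(Up, Um) : E → K × K` is bijective.  If `M` is maximal isotropic for `ω`, then `Up` maps `M`
bijectively onto `K`, and `M` contains its `ω`-orthogonal complement. -/
theorem maximal_isotropic_split {E K : Type*} [AddCommGroup E] [Module ℂ E]
    [FiniteDimensional ℂ E]
    [NormedAddCommGroup K] [InnerProductSpace ℂ K] [FiniteDimensional ℂ K] (Up Um : E →ₗ[ℂ] K)
    (hU : Function.Bijective (Up.prod Um)) (ω : E → E → ℂ) {c : ℂ} (hc : c ≠ 0)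
    (hω : ∀ ξ η, inner ℂ (Up ξ) (Up η) - inner ℂ (Um ξ) (Um η) = c * ω ξ η) {M : Submodule ℂ E}
    (hM : Maximal (fun N : Submodule ℂ E => ∀ ξ ∈ N, ∀ η ∈ N, ω ξ η = 0) M) :
    Function.Bijective (Up.domRestrict M) ∧ ∀ η, (∀ ξ ∈ M, ω ξ η = 0) → η ∈ M := by
  have hω' : ∀ ξ η, ω ξ η = 0 ↔ inner ℂ (Up ξ) (Up η) = inner ℂ (Um ξ) (Um η) := fun ξ η => by
    rw [← sub_eq_zero (a := inner ℂ _ _), hω, mul_eq_zero, or_iff_right hc]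
  simp only [hω'] at hM ⊢
  have hiso := hM.prop
  have hzero : ∀ ξ, Up ξ = 0 → Um ξ = 0 → ξ = 0 := fun ξ h1 h2 =>
    hU.1 (by simp [h1, h2])
  -- On M the two norms coincide, so a zero of one map is a zero of both.
  have hp : ∀ ξ ∈ M, Up ξ = 0 → ξ = 0 := fun ξ hξ h => by
    have h1 := hiso ξ hξ ξ hξ
    rw [h, inner_zero_left, eq_comm, inner_self_eq_zero] at h1
    exact hzero ξ h h1
  have hm : ∀ ξ ∈ M, Um ξ = 0 → ξ = 0 := fun ξ hξ h => by
    have h1 := hiso ξ hξ ξ hξ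
    rw [h, inner_zero_left, inner_self_eq_zero] at h1
    exact hzero ξ h1 h
  have ip : Function.Injective (Up.domRestrict M) := by
    rw [← LinearMap.ker_eq_bot, LinearMap.ker_eq_bot']
    rintro ⟨x, hx⟩ h
    exact Subtype.ext (hp x hx h)
  have im : Function.Injective (Um.domRestrict M) := by
    rw [← LinearMap.ker_eq_bot, LinearMap.ker_eq_bot']
    rintro ⟨x, hx⟩ h
    exact Subtype.ext (hm x hx h)
  have hfin : Module.finrank ℂ (LinearMap.range (Up.domRestrict M)) =
      Module.finrank ℂ (LinearMap.range (Um.domRestrict M)) := by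
    rw [LinearMap.finrank_range_of_inj ip, LinearMap.finrank_range_of_inj im]
  -- The images of M have equal dimension, so if one is proper both are. Unit vectors e, f
  -- orthogonal to them give ξ with coordinates (e, f), which is isotropic because ‖e‖ = ‖f‖ and is
  -- orthogonal to M; adjoining it contradicts maximality.
  have key : LinearMap.range (Up.domRestrict M) = ⊤ := by
    by_contra hne
    have hne' : LinearMap.range (Um.domRestrict M) ≠ ⊤ := by
      intro h
      apply hne
      apply Submodule.eq_top_of_finrank_eq
      rw [hfin, h, finrank_top]
    have unit : ∀ S : Submodule ℂ K, S ≠ ⊤ → ∃ e ∈ Sᗮ, ‖e‖ = 1 := by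
      intro S hS
      have : Sᗮ ≠ ⊥ := fun h => hS (Submodule.orthogonal_eq_bot_iff.1 h)
      obtain ⟨x, hx, hx0⟩ := Submodule.exists_mem_ne_zero_of_ne_bot this
      refine ⟨((‖x‖ : ℂ)⁻¹) • x, Submodule.smul_mem _ _ hx, ?_⟩
      exact norm_smul_inv_norm hx0
    obtain ⟨e, he, he1⟩ := unit _ hne
    obtain ⟨f, hf, hf1⟩ := unit _ hne'
    obtain ⟨ξ, hξ⟩ := hU.2 (e, f)
    have h1 : Up ξ = e := congrArg Prod.fst hξ
    have h2 : Um ξ = f := congrArg Prod.snd hξ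
    have o1 : ∀ m ∈ M, inner ℂ (Up m) e = 0 := fun m hm =>
      (Submodule.mem_orthogonal _ _).1 he _ ⟨⟨m, hm⟩, rfl⟩
    have o2 : ∀ m ∈ M, inner ℂ (Um m) f = 0 := fun m hm =>
      (Submodule.mem_orthogonal _ _).1 hf _ ⟨⟨m, hm⟩, rfl⟩
    have o1' : ∀ m ∈ M, inner ℂ e (Up m) = 0 := fun m hm => inner_eq_zero_symm.1 (o1 m hm)
    have o2' : ∀ m ∈ M, inner ℂ f (Um m) = 0 := fun m hm => inner_eq_zero_symm.1 (o2 m hm)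
    have hle := hM.le_of_ge (y := M ⊔ ℂ ∙ ξ) (by
      intro x hx y hy
      obtain ⟨m, hm, z, hz, rfl⟩ := Submodule.mem_sup.1 hx
      obtain ⟨m', hm', z', hz', rfl⟩ := Submodule.mem_sup.1 hy
      obtain ⟨c, rfl⟩ := Submodule.mem_span_singleton.1 hz
      obtain ⟨c', rfl⟩ := Submodule.mem_span_singleton.1 hz'
      simp only [map_add, map_smul, h1, h2, inner_add_left, inner_add_right, inner_smul_left,
        inner_smul_right, o1 m hm, o2 m hm, o1' m' hm', o2' m' hm', hiso m hm m' hm',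
        inner_self_eq_norm_sq_to_K, he1, hf1]) le_sup_left
    have hξM : ξ ∈ M := hle (Submodule.mem_sup_right (Submodule.mem_span_singleton_self ξ))
    have := o1 ξ hξM
    rw [h1, inner_self_eq_zero] at this
    rw [this, norm_zero] at he1
    exact zero_ne_one he1
  have key' : LinearMap.range (Um.domRestrict M) = ⊤ := by
    apply Submodule.eq_top_of_finrank_eq
    rw [← hfin, key, finrank_top]
  refine ⟨⟨ip, LinearMap.range_eq_top.1 key⟩, fun η hη => ?_⟩
  obtain ⟨⟨m, hm⟩, h⟩ := LinearMap.range_eq_top.1 key (Up η)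
  replace h : Up m = Up η := h
  have h1 : Up (η - m) = 0 := by rw [map_sub, h, sub_self]
  -- This vector is orthogonal to `Um` of all of M, which is the whole space.
  have h2 : Um (η - m) = 0 := by
    obtain ⟨⟨m', hm'⟩, h'⟩ := LinearMap.range_eq_top.1 key' (Um (η - m))
    replace h' : Um m' = Um (η - m) := h'
    have : inner ℂ (Um m') (Um (η - m)) = 0 := by
      rw [map_sub, inner_sub_right, ← hη m' hm', ← hiso m' hm' m hm, ← inner_sub_right,
        ← map_sub, h1, inner_zero_right]
    rwa [h', inner_self_eq_zero] at this
  rw [← sub_eq_zero.1 (hzero _ h1 h2)] at hm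
  exact hm

/-! ### The symplectic form on 𝒦² and kernels of pairs (A, B) -/

section

set_option linter.unusedSectionVars false

variable {Ep Em Ip Im : Type*} [Fintype Ep] [Fintype Em] [Fintype Ip] [Fintype Im]
  [DecidableEq Ep] [DecidableEq Em] [DecidableEq Ip] [DecidableEq Im]

open scoped ComplexOrder in
theorem eq_zero_of_star_dotProduct_self {ι : Type*} [Fintype ι] (v : ι → ℂ)
    (h : star v ⬝ᵥ v = 0) : v = 0 :=
  dotProduct_star_self_eq_zero.1 h

theorem Jnm_mul_self : Jnm Ep Em Ip Im * Jnm Ep Em Ip Im = 1 := by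
  simp [Jnm, Matrix.fromBlocks_multiply]

theorem Jnm_conjTranspose : (Jnm Ep Em Ip Im)ᴴ = Jnm Ep Em Ip Im := by
  simp [Jnm, Matrix.fromBlocks_conjTranspose]

theorem symplecticMatrix_eq : symplecticMatrix Ep Em Ip Im =
    Matrix.fromBlocks 0 (-Jnm Ep Em Ip Im) (Jnm Ep Em Ip Im) 0 := by
  simp [symplecticMatrix, Jnm, Matrix.fromBlocks_neg]

theorem symplecticMatrix_conjTranspose :
    (symplecticMatrix Ep Em Ip Im)ᴴ = -symplecticMatrix Ep Em Ip Im := by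
  simp [symplecticMatrix_eq, Matrix.fromBlocks_conjTranspose, Jnm_conjTranspose,
    Matrix.fromBlocks_neg]

set_option synthInstance.maxSize 1000 in
theorem symplecticMatrix_mul_self :
    symplecticMatrix Ep Em Ip Im * symplecticMatrix Ep Em Ip Im = -1 := by
  rw [symplecticMatrix_eq, Matrix.fromBlocks_multiply, ← Matrix.fromBlocks_one,
    Matrix.fromBlocks_neg]
  simp [Jnm_mul_self]

theorem symplecticForm_eq_dotProduct (ξ η : K2 Ep Em Ip Im) :
    symplecticForm ξ η = star ξ.ofLp ⬝ᵥ (symplecticMatrix Ep Em Ip Im *ᵥ η.ofLp) := by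
  rw [symplecticForm, EuclideanSpace.inner_eq_star_dotProduct, dotProduct_comm]

theorem symplecticForm_eq (ξ η : K2 Ep Em Ip Im) : symplecticForm ξ η =
    (∑ k, starRingEnd ℂ (ξ (.inr (.inl k))) * η (.inl (.inl k)) -
      ∑ k, starRingEnd ℂ (ξ (.inl (.inl k))) * η (.inr (.inl k))) -
    (∑ k, starRingEnd ℂ (ξ (.inr (.inr k))) * η (.inl (.inr k)) -
      ∑ k, starRingEnd ℂ (ξ (.inl (.inr k))) * η (.inr (.inr k))) := by
  have h : symplecticMatrix Ep Em Ip Im *ᵥ η.ofLp =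
      Sum.elim (Sum.elim (fun k => -η (.inr (.inl k))) (fun k => η (.inr (.inr k))))
        (Sum.elim (fun k => η (.inl (.inl k))) (fun k => -η (.inl (.inr k)))) := by
    ext ((k | k) | (k | k)) <;>
    simp [symplecticMatrix, Matrix.mulVec, dotProduct, Matrix.one_apply]
  rw [symplecticForm_eq_dotProduct, h]
  simp only [dotProduct, Fintype.sum_sum_type (α₁ := Index Ep Em Ip Im),
    Fintype.sum_sum_type (α₁ := HalfIndex Ep Ip), Pi.star_apply, Sum.elim_inl, Sum.elim_inr,
    RCLike.star_def, mul_neg, Finset.sum_neg_distrib]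
  ring

/-- The signature `±1` of an index. -/
def indexSign : Index Ep Em Ip Im → ℂ := Sum.elim (fun _ => 1) (fun _ => -1)

/-- The maps `ξ ↦ ξ₁ + c J ξ₂`; for `c = ± i` they diagonalize the symplectic form. -/
def cayleyMap (c : ℂ) : K2 Ep Em Ip Im →ₗ[ℂ] K Ep Em Ip Im where
  toFun ξ := WithLp.toLp 2 fun k => ξ (.inl k) + c * (indexSign k * ξ (.inr k))
  map_add' ξ η := by ext k; simp; ring
  map_smul' a ξ := by ext k; simp; ring

theorem cayleyMap_bijective : Function.Bijective
    ((cayleyMap (Ep := Ep) (Em := Em) (Ip := Ip) (Im := Im) Complex.I).prod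
      (cayleyMap (-Complex.I))) := by
  have hs : ∀ k : Index Ep Em Ip Im, indexSign k * indexSign k = 1 := by
    rintro (k | k) <;> simp [indexSign]
  constructor
  · rw [← LinearMap.ker_eq_bot, LinearMap.ker_eq_bot']
    intro ξ hξ
    have h1 := congrArg Prod.fst hξ
    have h2 := congrArg Prod.snd hξ
    have e1 : ∀ k, ξ (.inl k) + Complex.I * (indexSign k * ξ (.inr k)) = 0 := fun k =>
      congrFun (congrArg WithLp.ofLp h1) k
    have e2 : ∀ k, ξ (.inl k) + -Complex.I * (indexSign k * ξ (.inr k)) = 0 := fun k =>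
      congrFun (congrArg WithLp.ofLp h2) k
    ext (k | k)
    · simp only [PiLp.zero_apply]
      linear_combination (1/2) * e1 k + (1/2) * e2 k
    · simp only [PiLp.zero_apply]
      linear_combination (-Complex.I/2 * indexSign k) * (e1 k - e2 k) +
        ξ (.inr k) * (-hs k) +
        (indexSign k * indexSign k * ξ (.inr k)) * (Complex.I_mul_I)
  · rintro ⟨p, q⟩
    -- Solves ξ₁ + iJξ₂ = p, ξ₁ − iJξ₂ = q, using J² = 1.
    refine ⟨WithLp.toLp 2 (Sum.elim (fun k => (p k + q k) / 2)
      (fun k => indexSign k * (-Complex.I / 2) * (p k - q k))), ?_⟩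
    ext k
    · simp only [LinearMap.prod_apply, Function.prod_apply, cayleyMap, LinearMap.coe_mk,
        AddHom.coe_mk, Sum.elim_inl, Sum.elim_inr]
      linear_combination (-Complex.I * Complex.I * (p k - q k) / 2) * hs k -
        ((p k - q k) / 2) * Complex.I_mul_I
    · simp only [LinearMap.prod_apply, Function.prod_apply, cayleyMap, LinearMap.coe_mk,
        AddHom.coe_mk, Sum.elim_inl, Sum.elim_inr]
      linear_combination (Complex.I * Complex.I * (p k - q k) / 2) * hs k +
        ((p k - q k) / 2) * Complex.I_mul_I

/-- The pure ξ₁, η₁ and ξ₂, η₂ terms do not depend on the sign of i and cancel; the mixed terms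
double, and J supplies the opposite sign on negative edges. -/
theorem inner_cayleyMap_sub (ξ η : K2 Ep Em Ip Im) :
    inner ℂ (cayleyMap Complex.I ξ) (cayleyMap Complex.I η) -
      inner ℂ (cayleyMap (-Complex.I) ξ) (cayleyMap (-Complex.I) η) =
    (-2 * Complex.I) * symplecticForm ξ η := by
  rw [symplecticForm_eq, PiLp.inner_apply, PiLp.inner_apply]
  simp only [Fintype.sum_sum_type (α₁ := HalfIndex Ep Ip), cayleyMap, indexSign, LinearMap.coe_mk,
    AddHom.coe_mk, Sum.elim_inl, Sum.elim_inr, RCLike.inner_apply, map_add, map_mul, map_neg,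
    Complex.conj_I, map_one]
  rw [add_sub_add_comm, mul_sub]
  simp only [← Finset.sum_sub_distrib, Finset.mul_sum]
  rw [sub_eq_add_neg (Finset.sum _ _), ← Finset.sum_neg_distrib]
  congr 1 <;> exact Finset.sum_congr rfl fun k _ => by ring

theorem IsMaximalIsotropic.split {M : Submodule ℂ (K2 Ep Em Ip Im)} (h : IsMaximalIsotropic M) :
    Function.Bijective ((cayleyMap Complex.I).domRestrict M) ∧
      ∀ η, (∀ ξ ∈ M, symplecticForm ξ η = 0) → η ∈ M := by
  have h' := maximal_isotropic_split (cayleyMap (Ep := Ep) (Em := Em) (Ip := Ip) (Im := Im)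
    Complex.I) (cayleyMap (-Complex.I)) cayleyMap_bijective symplecticForm
    (c := -2 * Complex.I) (by simp) inner_cayleyMap_sub h
  exact ⟨h'.1, h'.2⟩

/-- Any isotropic subspace containing M lies in the complement of M, which gives the converse; the
forward direction is the signature argument of `maximal_isotropic_split`. -/
theorem isMaximalIsotropic_iff (M : Submodule ℂ (K2 Ep Em Ip Im)) :
    IsMaximalIsotropic M ↔ ∀ η, η ∈ M ↔ ∀ ξ ∈ M, symplecticForm ξ η = 0 := by
  constructor
  · intro h η
    refine ⟨fun hη ξ hξ => h.prop ξ hξ η hη, fun hη => ?_⟩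
    exact h.split.2 η hη
  · intro h
    refine ⟨fun ξ hξ η hη => (h η).1 hη ξ hξ, fun N hN hMN η hη => (h η).2 fun ξ hξ => ?_⟩
    exact hN ξ (hMN hξ) η hη

theorem IsMaximalIsotropic.finrank_eq {M : Submodule ℂ (K2 Ep Em Ip Im)}
    (h : IsMaximalIsotropic M) : Module.finrank ℂ M = Fintype.card (Index Ep Em Ip Im) := by
  rw [(LinearEquiv.ofBijective _ h.split.1).finrank_eq, finrank_euclideanSpace]

theorem mem_kerAB {A B : Matrix (Index Ep Em Ip Im) (Index Ep Em Ip Im) ℂ}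
    {η : K2 Ep Em Ip Im} : η ∈ kerAB A B ↔ Matrix.fromCols A B *ᵥ η.ofLp = 0 := Iff.rfl

/-- Condition (2) thereby becomes N S N* = 0 for N = (A, B). -/
theorem fromCols_mul_symplecticMatrix_mul (A B : Matrix (Index Ep Em Ip Im) (Index Ep Em Ip Im) ℂ) :
    Matrix.fromCols A B * symplecticMatrix Ep Em Ip Im * (Matrix.fromCols A B)ᴴ =
      B * Jnm Ep Em Ip Im * Aᴴ - A * Jnm Ep Em Ip Im * Bᴴ := by
  rw [symplecticMatrix_eq, Matrix.fromCols_mul_fromBlocks,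
    Matrix.conjTranspose_fromCols_eq_fromRows_conjTranspose, Matrix.fromCols_mul_fromRows]
  simp [sub_eq_add_neg]

theorem finrank_range_add_finrank_kerAB (A B : Matrix (Index Ep Em Ip Im) (Index Ep Em Ip Im) ℂ) :
    (Matrix.fromCols A B).rank + Module.finrank ℂ (kerAB A B) =
      Fintype.card (Index Ep Em Ip Im) + Fintype.card (Index Ep Em Ip Im) := by
  have h := LinearMap.finrank_range_add_finrank_ker
    ((Matrix.fromCols A B).mulVecLin ∘ₗ (WithLp.linearEquiv 2 ℂ
      (Index Ep Em Ip Im ⊕ Index Ep Em Ip Im → ℂ)).toLinearMap)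
  rw [finrank_euclideanSpace, Fintype.card_sum, LinearEquiv.range_comp] at h
  exact h

theorem card_index : Fintype.card (Index Ep Em Ip Im) =
    (2 * Fintype.card Ip + Fintype.card Ep) + (2 * Fintype.card Im + Fintype.card Em) := by
  simp only [Fintype.card_sum]
  ring

set_option synthInstance.maxSize 1000 in
open scoped ComplexOrder in
theorem isMaximalIsotropic_iff_exists_kerAB (M : Submodule ℂ (K2 Ep Em Ip Im)) :
    IsMaximalIsotropic M ↔ ∃ A B, BoundaryCondition A B ∧ M = kerAB A B := by
  constructor
  · intro h
    have hd := h.finrank_eq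
    -- Since dim M = n + m, a basis can be indexed like the boundary values, so that N has the shape
    -- of (A, B). Its rows are the functionals ω(b_k, ·), and their common kernel is the complement
    -- of M, which is M.
    let b := (Module.finBasisOfFinrankEq ℂ M hd).reindex (Fintype.equivFin _).symm
    let W : Matrix (Index Ep Em Ip Im ⊕ Index Ep Em Ip Im) (Index Ep Em Ip Im) ℂ :=
      Matrix.of fun i k => (b k : K2 Ep Em Ip Im) i
    let N := Wᴴ * symplecticMatrix Ep Em Ip Im
    have hN : Matrix.fromCols N.toCols₁ N.toCols₂ = N := Matrix.fromCols_toCols N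
    have hform : ∀ k (η : K2 Ep Em Ip Im), (N *ᵥ η.ofLp) k = symplecticForm (b k : K2 Ep Em Ip Im) η := by
      intro k η
      rw [symplecticForm_eq_dotProduct, ← Matrix.mulVec_mulVec]
      rfl
    have hker : M = kerAB N.toCols₁ N.toCols₂ := by
      ext η
      rw [mem_kerAB, hN, (isMaximalIsotropic_iff M).1 h η]
      constructor
      · intro hη
        ext k
        rw [hform, hη _ (b k).2, Pi.zero_apply]
      · intro hη ξ hξ
        have e := congrArg (Subtype.val) (b.sum_repr ⟨ξ, hξ⟩)
        simp only [Submodule.coe_sum, Submodule.coe_smul] at e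
        rw [← e, symplecticForm, sum_inner]
        refine Finset.sum_eq_zero fun k _ => ?_
        rw [inner_smul_left]
        have := hform k η
        rw [hη, Pi.zero_apply, symplecticForm] at this
        rw [← this, mul_zero]
    refine ⟨N.toCols₁, N.toCols₂, ⟨?_, ?_⟩, hker⟩
    · have := finrank_range_add_finrank_kerAB N.toCols₁ N.toCols₂
      rw [← hker, hd] at this
      rw [← card_index]
      omega
    · rw [← sub_eq_zero, ← fromCols_mul_symplecticMatrix_mul, hN]
      have : Wᴴ * symplecticMatrix Ep Em Ip Im * W = 0 := by
        ext k l
        have := h.prop (b k) (b k).2 (b l) (b l).2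
        rw [← hform] at this
        exact this
      -- As S² = −1 and S* = −S, the product reduces to the Gram matrix of ω on the basis, which
      -- vanishes by isotropy.
      calc N * symplecticMatrix Ep Em Ip Im * Nᴴ
          = Wᴴ * (symplecticMatrix Ep Em Ip Im * symplecticMatrix Ep Em Ip Im) *
              ((symplecticMatrix Ep Em Ip Im)ᴴ * W) := by
            simp only [N, Matrix.conjTranspose_mul, Matrix.conjTranspose_conjTranspose,
              Matrix.mul_assoc]
        _ = Wᴴ * symplecticMatrix Ep Em Ip Im * W := by
            rw [symplecticMatrix_mul_self, symplecticMatrix_conjTranspose]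
            simp [Matrix.mul_assoc]
        _ = 0 := this
  · rintro ⟨A, B, ⟨hr, hJ⟩, rfl⟩
    have hNS : Matrix.fromCols A B * symplecticMatrix Ep Em Ip Im * (Matrix.fromCols A B)ᴴ = 0 := by
      rw [fromCols_mul_symplecticMatrix_mul, hJ, sub_self]
    set N := Matrix.fromCols A B with hN
    let S := symplecticMatrix Ep Em Ip Im
    let L : (Index Ep Em Ip Im → ℂ) →ₗ[ℂ] K2 Ep Em Ip Im :=
      (WithLp.linearEquiv 2 ℂ _).symm.toLinearMap ∘ₗ (S * Nᴴ).mulVecLin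
    have hLle : LinearMap.range L ≤ kerAB A B := by
      rintro _ ⟨x, rfl⟩
      rw [mem_kerAB]
      change N *ᵥ ((S * Nᴴ) *ᵥ x) = 0
      rw [Matrix.mulVec_mulVec, ← Matrix.mul_assoc, hNS, Matrix.zero_mulVec]
    have hLrank : Module.finrank ℂ (LinearMap.range L) = N.rank := by
      rw [LinearMap.range_comp, LinearEquiv.finrank_map_eq]
      change (S * Nᴴ).rank = _
      rw [← Matrix.rank_conjTranspose N]
      refine le_antisymm (Matrix.rank_mul_le_right _ _) ?_
      have : Nᴴ = -S * (S * Nᴴ) := by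
        rw [← Matrix.mul_assoc, neg_mul, symplecticMatrix_mul_self, neg_neg, Matrix.one_mul]
      conv_lhs => rw [this]
      exact Matrix.rank_mul_le_right _ _
    have hrange : LinearMap.range L = kerAB A B := by
      apply Submodule.eq_of_le_of_finrank_eq hLle
      have := finrank_range_add_finrank_kerAB A B
      rw [hLrank]
      rw [card_index, ← hN] at this
      omega
    have hform : ∀ x η, symplecticForm (L x) η = star x ⬝ᵥ (N *ᵥ η.ofLp) := by
      intro x η
      rw [symplecticForm_eq_dotProduct]
      change star ((S * Nᴴ) *ᵥ x) ⬝ᵥ (S *ᵥ η.ofLp) = _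
      rw [Matrix.star_mulVec, ← Matrix.dotProduct_mulVec, Matrix.mulVec_mulVec,
        Matrix.conjTranspose_mul, Matrix.conjTranspose_conjTranspose, Matrix.mul_assoc]
      simp only [S, symplecticMatrix_conjTranspose, neg_mul, symplecticMatrix_mul_self, neg_neg,
        Matrix.mul_one]
    rw [isMaximalIsotropic_iff]
    intro η
    rw [← hrange]
    constructor
    · rintro hη _ ⟨x, rfl⟩
      rw [hrange, mem_kerAB] at hη
      rw [hform, hη, dotProduct_zero]
    · intro h
      rw [hrange, mem_kerAB]
      -- Testing against x = Nη yields (Nη)*(Nη) = 0.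
      have h1 := h (L (N *ᵥ η.ofLp)) (LinearMap.mem_range_self L _)
      rw [hform] at h1
      exact eq_zero_of_star_dotProduct_self _ h1

end

/-! ### Absolute continuity and Green's formula on one edge -/

open Filter Topology

theorem absolutelyContinuousOnInterval_of_dist_le {X Y : Type*} [PseudoMetricSpace X]
    [PseudoMetricSpace Y] {f : ℝ → X} {h : ℝ → Y} {a b : ℝ}
    (hh : AbsolutelyContinuousOnInterval h a b)
    (H : ∀ x ∈ uIcc a b, ∀ y ∈ uIcc a b, dist (f x) (f y) ≤ dist (h x) (h y)) :
    AbsolutelyContinuousOnInterval f a b := by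
  rw [absolutelyContinuousOnInterval_iff] at hh ⊢
  intro ε hε
  obtain ⟨δ, hδ, h1⟩ := hh ε hε
  refine ⟨δ, hδ, fun E hE hE' => lt_of_le_of_lt (Finset.sum_le_sum fun i hi => ?_) (h1 E hE hE')⟩
  exact H _ (hE.1 i hi).1 _ (hE.1 i hi).2

/-- The increments are dominated by those of the real primitive of ‖f‖. -/
theorem absolutelyContinuousOnInterval_integral {f : ℝ → ℂ} {a b c : ℝ}
    (h : IntervalIntegrable f volume a b) (hc : c ∈ uIcc a b) :
    AbsolutelyContinuousOnInterval (fun x => ∫ v in c..x, f v) a b := by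
  refine absolutelyContinuousOnInterval_of_dist_le
    (h.norm.absolutelyContinuousOnInterval_intervalIntegral hc) fun x hx y hy => ?_
  have h1 : ∀ z ∈ uIcc a b, IntervalIntegrable f volume c z := fun z hz =>
    h.mono_set (uIcc_subset_uIcc hc hz)
  rw [dist_eq_norm, dist_eq_norm, intervalIntegral.integral_interval_sub_left (h1 x hx) (h1 y hy),
    intervalIntegral.integral_interval_sub_left (h1 x hx).norm (h1 y hy).norm]
  exact intervalIntegral.norm_integral_le_abs_integral_norm

/-- Subtracting the primitive of w leaves an absolutely continuous function with derivative zero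
almost everywhere, hence a constant. -/
theorem integral_eq_sub_of_absolutelyContinuousOnInterval {f w : ℝ → ℂ} {a b : ℝ}
    (hf : AbsolutelyContinuousOnInterval f a b) (hw : IntervalIntegrable w volume a b)
    (hd : ∀ᵐ x, x ∈ uIcc a b → HasDerivAt f (w x) x) : ∫ x in a..b, w x = f b - f a := by
  have hac := hf.fun_sub (absolutelyContinuousOnInterval_integral hw left_mem_uIcc)
  obtain ⟨C, hC⟩ := hac.const_of_ae_hasDerivAt_zero (by
    filter_upwards [hd, hw.ae_hasDerivAt_integral] with x h1 h2 hx
    simpa using (h1 hx).fun_sub (h2 hx a left_mem_uIcc))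
  have h1 := hC a left_mem_uIcc
  have h2 := hC b right_mem_uIcc
  rw [intervalIntegral.integral_same, sub_zero] at h1
  rw [← h1] at h2
  linear_combination -h2

theorem absolutelyContinuousOnInterval_inner {f g : ℝ → ℂ} {a b : ℝ}
    (hf : AbsolutelyContinuousOnInterval f a b) (hg : AbsolutelyContinuousOnInterval g a b) :
    AbsolutelyContinuousOnInterval (fun x => inner ℂ (f x) (g x)) a b := by
  have h1 : AbsolutelyContinuousOnInterval (fun x => starRingEnd ℂ (f x)) a b :=
    absolutelyContinuousOnInterval_of_dist_le hf fun x _ y _ => by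
      rw [Complex.dist_conj_conj]
  simp only [RCLike.inner_apply]
  exact hg.fun_smul h1

theorem intervalIntegrable_inner {f g : ℝ → ℂ} {a b : ℝ}
    (hf : IntervalIntegrable f volume a b) (hg : ContinuousOn g (uIcc a b)) :
    IntervalIntegrable (fun x => inner ℂ (f x) (g x)) volume a b := by
  have h1 : IntervalIntegrable (fun x => starRingEnd ℂ (f x)) volume a b :=
    ⟨Complex.conjCLE.toContinuousLinearMap.integrable_comp hf.1,
      Complex.conjCLE.toContinuousLinearMap.integrable_comp hf.2⟩
  simpa only [RCLike.inner_apply] using h1.continuousOn_mul hg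

theorem intervalIntegrable_inner' {f g : ℝ → ℂ} {a b : ℝ}
    (hf : ContinuousOn f (uIcc a b)) (hg : IntervalIntegrable g volume a b) :
    IntervalIntegrable (fun x => inner ℂ (f x) (g x)) volume a b := by
  have h1 : ContinuousOn (fun x => starRingEnd ℂ (f x)) (uIcc a b) :=
    Complex.continuous_conj.comp_continuousOn hf
  simpa only [RCLike.inner_apply] using hg.mul_continuousOn h1

/-- `f` has the absolutely continuous derivative `g`, and `g` has the integrable derivative `w`,
almost everywhere on the segment between `a` and `b`. -/
structure IsSegRep (a b : ℝ) (w f g : ℝ → ℂ) : Prop where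
  ac : AbsolutelyContinuousOnInterval f a b
  ac_deriv : AbsolutelyContinuousOnInterval g a b
  deriv : ∀ᵐ x, x ∈ uIcc a b → HasDerivAt f (g x) x
  deriv2 : ∀ᵐ x, x ∈ uIcc a b → HasDerivAt g (w x) x
  integrable : IntervalIntegrable w volume a b

/-- The boundary term of Green's formula. -/
noncomputable def wronskian (f g f' g' : ℝ → ℂ) (x : ℝ) : ℂ :=
  inner ℂ (g x) (f' x) - inner ℂ (f x) (g' x)

theorem IsSegRep.green {a b : ℝ} {w f g w' f' g' : ℝ → ℂ} (h : IsSegRep a b w f g)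
    (h' : IsSegRep a b w' f' g') :
    ∫ x in a..b, (inner ℂ (w x) (f' x) - inner ℂ (f x) (w' x)) =
      wronskian f g f' g' b - wronskian f g f' g' a := by
  apply integral_eq_sub_of_absolutelyContinuousOnInterval
  · exact (absolutelyContinuousOnInterval_inner h.ac_deriv h'.ac).fun_sub
      (absolutelyContinuousOnInterval_inner h.ac h'.ac_deriv)
  · exact (intervalIntegrable_inner h.integrable h'.ac.continuousOn).sub
      (intervalIntegrable_inner' h.ac.continuousOn h'.integrable)
  · filter_upwards [h.deriv, h.deriv2, h'.deriv, h'.deriv2] with x h1 h2 h3 h4 hx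
    -- In the derivative of the Wronskian the two terms ⟨g, g'⟩ cancel.
    exact (((h2 hx).inner ℂ (h3 hx)).fun_sub ((h1 hx).inner ℂ (h4 hx))).congr_deriv
      (by ring)

theorem memLp_restrict_mono {I S : Set ℝ} {w : ℝ → ℂ} (hS : S ⊆ I)
    (hw : MemLp w 2 (volume.restrict I)) : MemLp w 2 (volume.restrict S) :=
  hw.mono_measure (Measure.restrict_mono hS le_rfl)

theorem intervalIntegrable_of_memLp {I : Set ℝ} {w : ℝ → ℂ} {a b : ℝ} (hI : uIcc a b ⊆ I)
    (hw : MemLp w 2 (volume.restrict I)) : IntervalIntegrable w volume a b := by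
  rw [intervalIntegrable_iff']
  have : IsFiniteMeasure (volume.restrict (uIcc a b)) := ⟨by simp [uIcc]⟩
  exact (memLp_restrict_mono hI hw).integrable one_le_two

/-- Discarding the two end points, a null set, turns one-sided derivatives into two-sided ones. -/
theorem IsRep.isSegRep {I : Set ℝ} (hm : MeasurableSet I) {u w : Lp ℂ 2 (volume.restrict I)}
    {f g : ℝ → ℂ} (h : IsRep I u w f g) {a b : ℝ} (hI : uIcc a b ⊆ I) : IsSegRep a b w f g where
  ac := h.ac a (hI left_mem_uIcc) b (hI right_mem_uIcc)
  ac_deriv := h.ac_deriv a (hI left_mem_uIcc) b (hI right_mem_uIcc)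
  integrable := intervalIntegrable_of_memLp hI (Lp.memLp w)
  deriv := by
    filter_upwards [Measure.ae_ne volume a, Measure.ae_ne volume b] with x ha hb hx
    refine (h.deriv x (hI hx)).hasDerivAt (mem_of_superset (Icc_mem_nhds ?_ ?_) hI)
    · exact lt_of_le_of_ne hx.1 (by rcases min_choice a b with e | e <;> rw [e] <;> exact Ne.symm ‹_›)
    · exact lt_of_le_of_ne hx.2 (by rcases max_choice a b with e | e <;> rw [e] <;> assumption)
  deriv2 := by
    filter_upwards [Measure.ae_ne volume a, Measure.ae_ne volume b,
      (ae_restrict_iff' hm).1 h.deriv2] with x ha hb h2 hx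
    refine (h2 (hI hx)).hasDerivAt (mem_of_superset (Icc_mem_nhds ?_ ?_) hI)
    · exact lt_of_le_of_ne hx.1 (by rcases min_choice a b with e | e <;> rw [e] <;> exact Ne.symm ‹_›)
    · exact lt_of_le_of_ne hx.2 (by rcases max_choice a b with e | e <;> rw [e] <;> assumption)

theorem IsRep.green_Icc {a : ℝ} (ha : 0 < a) {u w u' w' : Lp ℂ 2 (volume.restrict (Icc 0 a))}
    {f g f' g' : ℝ → ℂ} (h : IsRep (Icc 0 a) u w f g) (h' : IsRep (Icc 0 a) u' w' f' g') :
    inner ℂ w u' - inner ℂ u w' = wronskian f g f' g' a - wronskian f g f' g' 0 := by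
  have hs : uIcc 0 a ⊆ Icc 0 a := by rw [uIcc_of_le ha.le]
  rw [← (h.isSegRep measurableSet_Icc hs).green (h'.isSegRep measurableSet_Icc hs),
    intervalIntegral.integral_of_le ha.le, ← integral_Icc_eq_integral_Ioc, L2.inner_def,
    L2.inner_def, ← integral_sub (L2.integrable_inner _ _) (L2.integrable_inner _ _)]
  refine integral_congr_ae ?_
  filter_upwards [h.ae_eq, h'.ae_eq] with x h1 h2
  rw [h1, h2]

theorem IsRep.memLp {I : Set ℝ} {u w : Lp ℂ 2 (volume.restrict I)} {f g : ℝ → ℂ}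
    (h : IsRep I u w f g) : MemLp f 2 (volume.restrict I) :=
  (memLp_congr_ae h.ae_eq).1 (Lp.memLp u)

theorem integrable_inner_of_memLp {μ : Measure ℝ} {f g : ℝ → ℂ} (hf : MemLp f 2 μ)
    (hg : MemLp g 2 μ) : Integrable (fun x => inner ℂ (f x) (g x)) μ := by
  refine (L2.integrable_inner (𝕜 := ℂ) hf.toLp hg.toLp).congr ?_
  filter_upwards [hf.coeFn_toLp, hg.coeFn_toLp] with x h1 h2
  rw [h1, h2]

theorem uIcc_subset_Ici {b : ℝ} (hb : 0 ≤ b) : uIcc 0 b ⊆ Ici 0 := by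
  rw [uIcc_of_le hb]
  exact Icc_subset_Ici_self

/-- A square integrable function on the half line with square integrable second derivative has a
square integrable derivative. -/
theorem IsRep.memLp_deriv {u w : Lp ℂ 2 (volume.restrict (Ici (0 : ℝ)))} {f g : ℝ → ℂ}
    (h : IsRep (Ici 0) u w f g) : MemLp g 2 (volume.restrict (Ici 0)) := by
  have hgc : ContinuousOn g (Ici 0) := fun x hx => by
    have := (h.ac_deriv 0 self_mem_Ici (x + 1) (by simp only [mem_Ici] at hx ⊢; linarith)).continuousOn
    rw [uIcc_of_le (by simp only [mem_Ici] at hx; linarith)] at this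
    refine (this x ⟨hx, by linarith⟩).mono_of_mem_nhdsWithin ?_
    rw [← Ici_inter_Iic]
    exact inter_mem_nhdsWithin _ (Iic_mem_nhds (by linarith))
  have hgm : AEStronglyMeasurable g (volume.restrict (Ici 0)) :=
    hgc.aestronglyMeasurable measurableSet_Ici
  rw [memLp_two_iff_integrable_sq_norm hgm]
  have hfw : Integrable (fun x => inner ℂ (f x) (w x)) (volume.restrict (Ici 0)) :=
    integrable_inner_of_memLp h.memLp (Lp.memLp w)
  set G : ℝ → ℝ := fun b => ∫ x in 0..b, ‖g x‖ ^ 2 with hG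
  have hgi : ∀ b ∈ Ici (0 : ℝ), IntervalIntegrable (fun x => ‖g x‖ ^ 2) volume 0 b := fun b hb =>
    ((hgc.norm.pow 2).mono (uIcc_subset_Ici hb)).intervalIntegrable
  set K : ℝ := ∫ x in Ici (0 : ℝ), ‖inner ℂ (f x) (w x)‖ with hK
  -- Integrate ⟨f, g⟩' = ⟨f, w⟩ + ‖g‖² over [0, b]; the first term contributes at most K in absolute
  -- value.
  have hp : ∀ b ∈ Ici (0 : ℝ), (inner ℂ (f 0) (g 0) : ℂ).re + G b - K ≤
      (inner ℂ (f b) (g b) : ℂ).re := by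
    intro b hb
    have hs := h.isSegRep measurableSet_Ici (uIcc_subset_Ici hb)
    have hi1 := intervalIntegrable_inner' hs.ac.continuousOn hs.integrable
    have hi2 := intervalIntegrable_inner' hs.ac_deriv.continuousOn
      hs.ac_deriv.continuousOn.intervalIntegrable
    have e := integral_eq_sub_of_absolutelyContinuousOnInterval
      (absolutelyContinuousOnInterval_inner hs.ac hs.ac_deriv) (hi1.add hi2) (by
        filter_upwards [hs.deriv, hs.deriv2] with x h1 h2 hx
        exact (h1 hx).inner ℂ (h2 hx))
    rw [intervalIntegral.integral_add hi1 hi2] at e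
    have e2 : ∫ x in 0..b, inner ℂ (g x) (g x) = (G b : ℂ) := by
      rw [hG, ← intervalIntegral.integral_ofReal]
      simp only [inner_self_eq_norm_sq_to_K]
      push_cast
      rfl
    rw [e2] at e
    have e3 : ‖∫ x in 0..b, inner ℂ (f x) (w x)‖ ≤ K := by
      rw [intervalIntegral.integral_of_le hb]
      refine (norm_integral_le_integral_norm _).trans ?_
      exact setIntegral_mono_set hfw.norm (Eventually.of_forall fun _ => norm_nonneg _)
        (Eventually.of_forall fun x hx => hx.1.le)
    have e4 := congrArg Complex.re e
    simp only [Complex.add_re, Complex.sub_re, Complex.ofReal_re] at e4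
    have e5 := (abs_le.1 ((Complex.abs_re_le_norm _).trans e3)).1
    linarith
  by_cases hbd : ∃ C, ∀ b ∈ Ici (0 : ℝ), G b ≤ C
  · obtain ⟨C, hC⟩ := hbd
    have : IntegrableOn (fun x => ‖g x‖ ^ 2) (Ioi 0) := by
      refine integrableOn_Ioi_of_intervalIntegral_norm_bounded (l := atTop) (b := id) C 0
        (fun b => ?_) tendsto_id ?_
      · rcases le_total 0 b with hb | hb
        · exact (intervalIntegrable_iff_integrableOn_Ioc_of_le hb).1 (hgi b hb)
        · simp [Ioc_eq_empty_of_le hb]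
      · filter_upwards [eventually_ge_atTop 0] with b hb
        simpa using hC b hb
    exact (integrableOn_Ici_iff_integrableOn_Ioi (by simp)).2 this
  · exfalso
    push Not at hbd
    -- If the integral of ‖g‖² is unbounded, this threshold forces Re⟨f, g⟩ ≥ 1 from B on. Then ‖f‖²
    -- has derivative at least 2, which is incompatible with f being square integrable.
    obtain ⟨B, hB0, hB⟩ := hbd (K - (inner ℂ (f 0) (g 0) : ℂ).re + 1)
    have hB0' : (0 : ℝ) ≤ B := hB0
    have hp1 : ∀ b ∈ Ici B, 1 ≤ (inner ℂ (f b) (g b) : ℂ).re := by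
      intro b hb
      have hb' : B ≤ b := hb
      have h1 := hp b (hB0'.trans hb')
      have h2 : G B ≤ G b := by
        refine intervalIntegral.integral_mono_interval le_rfl hB0 hb
          (Eventually.of_forall fun _ => by positivity) (hgi b (hB0'.trans hb'))
      linarith
    have hd : ∀ x ∈ Ioi (0 : ℝ), HasDerivAt (fun y => (inner ℂ (f y) (f y) : ℂ).re - y)
        (2 * (inner ℂ (f x) (g x) : ℂ).re - 1) x := by
      intro x hx
      have h1 : HasDerivAt f (g x) x := (h.deriv x (Ioi_subset_Ici_self hx)).hasDerivAt (Ici_mem_nhds hx)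
      have h2 := (h1.inner ℂ h1)
      have h3 : HasDerivAt (fun y => (inner ℂ (f y) (f y) : ℂ).re)
          (inner ℂ (f x) (g x) + inner ℂ (g x) (f x) : ℂ).re x := by
        exact Complex.reCLM.hasFDerivAt.comp_hasDerivAt x h2
      refine (h3.sub (hasDerivAt_id x)).congr_deriv ?_
      rw [Complex.add_re, ← inner_conj_symm (g x) (f x), Complex.conj_re]
      ring
    -- The start B + 1 keeps the points positive even if B = 0, so two-sided derivatives exist; from
    -- B + 2 on, ‖f‖² ≥ 1.
    have hmono : MonotoneOn (fun y => (inner ℂ (f y) (f y) : ℂ).re - y) (Ici (B + 1)) := by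
      refine monotoneOn_of_deriv_nonneg (convex_Ici _) (fun x hx => ?_) (fun x hx => ?_)
        fun x hx => ?_
      · have hx' : B + 1 ≤ x := hx
        exact (hd x (by simp only [mem_Ioi]; linarith)).continuousAt.continuousWithinAt
      · rw [interior_Ici] at hx
        have hx' : B + 1 < x := hx
        exact (hd x (by simp only [mem_Ioi]; linarith)).differentiableAt.differentiableWithinAt
      · rw [interior_Ici] at hx
        have hx' : B + 1 < x := hx
        rw [(hd x (by simp only [mem_Ioi]; linarith)).deriv]
        have := hp1 x (by simp only [mem_Ici]; linarith)
        linarith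
    have hff : IntegrableOn (fun x => inner ℂ (f x) (f x)) (Ici (B + 2)) := by
      refine IntegrableOn.mono_set (integrable_inner_of_memLp h.memLp h.memLp) ?_
      exact Ici_subset_Ici.2 (by linarith)
    have hone : IntegrableOn (fun _ => (1 : ℝ)) (Ici (B + 2)) := by
      refine Integrable.mono hff aestronglyMeasurable_const ?_
      filter_upwards [ae_restrict_mem measurableSet_Ici] with x hx
      have hx' : B + 2 ≤ x := hx
      have h1 := hmono (a := B + 1) (b := x) self_mem_Ici (by simp only [mem_Ici]; linarith)
        (by linarith)
      have h2 : 0 ≤ (inner ℂ (f (B + 1)) (f (B + 1)) : ℂ).re := by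
        rw [inner_self_eq_norm_sq_to_K]
        norm_cast
        exact sq_nonneg _
      have h3 := Complex.re_le_norm (inner ℂ (f x) (f x))
      simp only at h1
      rw [norm_one]
      linarith
    have := (integrableOn_const_iff (C := (1 : ℝ))).1 hone
    simp at this

/-- There is no boundary term at infinity: the Wronskian converges because its derivative is
integrable, and it is itself integrable by `IsRep.memLp_deriv`, so its limit is 0. -/
theorem IsRep.green_Ici {u w u' w' : Lp ℂ 2 (volume.restrict (Ici (0 : ℝ)))}
    {f g f' g' : ℝ → ℂ} (h : IsRep (Ici 0) u w f g) (h' : IsRep (Ici 0) u' w' f' g') :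
    inner ℂ w u' - inner ℂ u w' = -wronskian f g f' g' 0 := by
  have hi : Integrable (fun x => inner ℂ (w x) (f' x) - inner ℂ (f x) (w' x))
      (volume.restrict (Ici 0)) :=
    (integrable_inner_of_memLp (Lp.memLp w) h'.memLp).sub
      (integrable_inner_of_memLp h.memLp (Lp.memLp w'))
  have hW : Integrable (wronskian f g f' g') (volume.restrict (Ici 0)) :=
    (integrable_inner_of_memLp h.memLp_deriv h'.memLp).sub
      (integrable_inner_of_memLp h.memLp h'.memLp_deriv)
  have hlim : Tendsto (wronskian f g f' g') atTop (𝓝 (wronskian f g f' g' 0 +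
      ∫ x in Ioi (0 : ℝ), (inner ℂ (w x) (f' x) - inner ℂ (f x) (w' x)))) := by
    have h1 := (intervalIntegral_tendsto_integral_Ioi 0
      ((integrableOn_Ici_iff_integrableOn_Ioi (by simp)).1 hi) tendsto_id).const_add (wronskian f g f' g' 0)
    refine h1.congr' ?_
    filter_upwards [eventually_ge_atTop 0] with b hb
    rw [id, (h.isSegRep measurableSet_Ici (uIcc_subset_Ici hb)).green
      (h'.isSegRep measurableSet_Ici (uIcc_subset_Ici hb))]
    ring
  have hzero := IntegrableAtFilter.eq_zero_of_tendsto (μ := volume)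
    ⟨Ici 0, Ici_mem_atTop 0, hW⟩ (fun s hs => by
      obtain ⟨b, hb⟩ := mem_atTop_sets.1 hs
      exact measure_mono_top (s₁ := Ici b) hb Real.volume_Ici) hlim
  rw [eq_neg_iff_add_eq_zero, add_comm, ← hzero, ← integral_Ici_eq_integral_Ioi, L2.inner_def,
    L2.inner_def, ← integral_sub (L2.integrable_inner _ _) (L2.integrable_inner _ _)]
  congr 1
  refine integral_congr_ae ?_
  filter_upwards [h.ae_eq, h'.ae_eq] with x h1 h2
  rw [h1, h2]

/-! ### Primitives and regularity of weak solutions -/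

/-- The primitive of `W` with value `c` at `0`. -/
noncomputable def primitive (W : ℝ → ℂ) (c : ℂ) (x : ℝ) : ℂ := c + ∫ t in 0..x, W t

theorem primitive_zero (W : ℝ → ℂ) (c : ℂ) : primitive W c 0 = c := by simp [primitive]

theorem intervalIntegrable_of_locallyIntegrable {W : ℝ → ℂ} (hW : LocallyIntegrable W) {a b : ℝ} :
    IntervalIntegrable W volume a b :=
  (intervalIntegrable_iff' (by simp)).2 (hW.integrableOn_isCompact isCompact_uIcc)

theorem continuous_primitive {W : ℝ → ℂ} (hW : LocallyIntegrable W) (c : ℂ) :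
    Continuous (primitive W c) :=
  continuous_const.add (intervalIntegral.continuous_primitive
    (fun _ _ => intervalIntegrable_of_locallyIntegrable hW) 0)

theorem absolutelyContinuousOnInterval_primitive {W : ℝ → ℂ} (hW : LocallyIntegrable W) (c : ℂ)
    (a b : ℝ) : AbsolutelyContinuousOnInterval (primitive W c) a b := by
  have h := absolutelyContinuousOnInterval_integral (intervalIntegrable_of_locallyIntegrable hW
    -- The segment is enlarged to contain the base point 0 of the primitive.
    (a := min (min a b) 0) (b := max (max a b) 0)) (c := 0)
    (Icc_subset_uIcc ⟨min_le_right _ _, le_max_right _ _⟩)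
  refine absolutelyContinuousOnInterval_of_dist_le (h.mono ?_) fun x _ y _ => ?_
  · exact fun x hx => Icc_subset_uIcc
      ⟨(min_le_left _ _).trans hx.1, hx.2.trans (le_max_left _ _)⟩
  · simp [primitive]

theorem hasDerivAt_primitive {W : ℝ → ℂ} (hW : Continuous W) (c : ℂ) (x : ℝ) :
    HasDerivAt (primitive W c) (W x) x :=
  (intervalIntegral.integral_hasDerivAt_right (hW.intervalIntegrable _ _)
    hW.aestronglyMeasurable.stronglyMeasurableAtFilter hW.continuousAt).const_add c

theorem ae_hasDerivAt_primitive {W : ℝ → ℂ} (hW : LocallyIntegrable W) (c : ℂ) :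
    ∀ᵐ x, HasDerivAt (primitive W c) (W x) x := by
  filter_upwards [LocallyIntegrable.ae_hasDerivAt_integral hW] with x hx
  exact (hx 0).const_add c

theorem isSegRep_primitive {W : ℝ → ℂ} (hW : LocallyIntegrable W) (c0 c1 : ℂ) (a b : ℝ) :
    IsSegRep a b W (primitive (primitive W c1) c0) (primitive W c1) where
  ac := absolutelyContinuousOnInterval_primitive (continuous_primitive hW c1).locallyIntegrable _ _ _
  ac_deriv := absolutelyContinuousOnInterval_primitive hW _ _ _
  deriv := Eventually.of_forall fun x _ => hasDerivAt_primitive (continuous_primitive hW c1) c0 x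
  deriv2 := (ae_hasDerivAt_primitive hW c1).mono fun _ hx _ => hx
  integrable := intervalIntegrable_of_locallyIntegrable hW

theorem isRep_primitive {I : Set ℝ} {W : ℝ → ℂ} (hW : LocallyIntegrable W)
    (c0 c1 : ℂ) {u w : Lp ℂ 2 (volume.restrict I)} (hw : w =ᵐ[volume.restrict I] W)
    (hu : u =ᵐ[volume.restrict I] primitive (primitive W c1) c0) :
    IsRep I u w (primitive (primitive W c1) c0) (primitive W c1) where
  ae_eq := hu
  ac a _ b _ := (isSegRep_primitive hW c0 c1 a b).ac
  ac_deriv a _ b _ := (isSegRep_primitive hW c0 c1 a b).ac_deriv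
  deriv x _ := (hasDerivAt_primitive (continuous_primitive hW c1) c0 x).hasDerivWithinAt
  deriv2 := by
    filter_upwards [hw, ae_restrict_of_ae (ae_hasDerivAt_primitive hW c1)] with x h1 h2
    rw [h1]
    exact h2.hasDerivWithinAt

theorem primitive_primitive_add {W : ℝ → ℂ} (hW : LocallyIntegrable W) (c0 c1 : ℂ) (x : ℝ) :
    primitive (primitive W c1) c0 x = primitive (primitive W 0) 0 x + (c0 + c1 * x) := by
  have : ∀ y, primitive W c1 y = c1 + primitive W 0 y := fun y => by simp [primitive]
  have h2 : ∫ t in 0..x, primitive W c1 t = ∫ t in 0..x, (c1 + primitive W 0 t) :=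
    intervalIntegral.integral_congr fun y _ => this y
  rw [primitive, primitive, h2, intervalIntegral.integral_add intervalIntegrable_const
    ((continuous_primitive hW 0).intervalIntegrable _ _)]
  simp
  ring

theorem locallyIntegrable_indicator {I : Set ℝ} (hm : MeasurableSet I) {w : ℝ → ℂ}
    (hw : MemLp w 2 (volume.restrict I)) : LocallyIntegrable (I.indicator w) :=
  ((memLp_indicator_iff_restrict hm).2 hw).locallyIntegrable one_le_two

/-- A square integrable function on `[0, a]` that is orthogonal to the affine functions is the
second derivative of a function vanishing to first order at the end points. -/
theorem primitive_eq_zero {a : ℝ} {W : ℝ → ℂ} (hW : LocallyIntegrable W)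
    (hsupp : ∀ x, x ∉ Icc 0 a → W x = 0) (h0 : ∫ x in 0..a, W x = 0)
    (h1 : ∫ x in 0..a, (x : ℂ) * W x = 0) {x : ℝ} (hx : x ∉ Ioo 0 a) :
    primitive W 0 x = 0 ∧ primitive (primitive W 0) 0 x = 0 := by
  have hneg : ∀ x ≤ 0, primitive W 0 x = 0 := by
    intro x hx
    rw [primitive, zero_add, intervalIntegral.integral_symm, intervalIntegral.integral_of_le hx,
      integral_Ioc_eq_integral_Ioo, setIntegral_eq_zero_of_forall_eq_zero, neg_zero]
    exact fun y hy => hsupp y fun hy' => (not_lt.2 hy'.1) hy.2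
  have hpos : ∀ x, a ≤ x → primitive W 0 x = 0 := by
    intro x hx
    rw [primitive, zero_add, ← intervalIntegral.integral_add_adjacent_intervals
      (intervalIntegrable_of_locallyIntegrable hW (a := 0) (b := a)) (intervalIntegrable_of_locallyIntegrable hW (a := a) (b := x)), h0,
      zero_add, intervalIntegral.integral_of_le hx]
    exact setIntegral_eq_zero_of_forall_eq_zero fun y hy =>
      hsupp y fun hy' => (not_lt.2 hy'.2) hy.1
  have hc := continuous_primitive hW 0
  have hS := isSegRep_primitive hW 0 0 0 a
  -- With F the double primitive, (xF' − F)' = xW. Integrating over [0, a] and using F'(a) = 0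
  -- leaves F(a) = 0.
  have hpa : primitive (primitive W 0) 0 a = 0 := by
    have hac : AbsolutelyContinuousOnInterval (fun x : ℝ => (x : ℂ)) 0 a := by
      refine absolutelyContinuousOnInterval_of_dist_le (h := fun x : ℝ => x) ?_ ?_
      · exact (LipschitzWith.id.lipschitzOnWith).absolutelyContinuousOnInterval
      · intro x _ y _
        rw [Complex.dist_eq, ← Complex.ofReal_sub, Complex.norm_real, Real.dist_eq, Real.norm_eq_abs]
    have hac' := (hac.fun_smul hS.ac_deriv).fun_sub hS.ac
    have e := integral_eq_sub_of_absolutelyContinuousOnInterval (w := fun x : ℝ => (x : ℂ) * W x)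
      hac' ((intervalIntegrable_of_locallyIntegrable hW).continuousOn_mul (by fun_prop)) (by
        filter_upwards [hS.deriv, hS.deriv2] with x e1 e2 hx
        have e3 : HasDerivAt (fun x : ℝ => (x : ℂ)) 1 x := Complex.ofRealCLM.hasDerivAt
        have e4 := (e3.mul (e2 hx)).sub (e1 hx)
        refine e4.congr_deriv ?_
        ring)
    rw [h1, hpos a le_rfl, primitive_zero, primitive_zero] at e
    simpa using e
  have hx' : x ≤ 0 ∨ a ≤ x := by
    by_contra hcon
    push Not at hcon
    exact hx hcon
  rcases hx' with hx' | hx'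
  · refine ⟨hneg x hx', ?_⟩
    rw [primitive, zero_add, intervalIntegral.integral_symm, intervalIntegral.integral_of_le hx',
      setIntegral_eq_zero_of_forall_eq_zero, neg_zero]
    exact fun y hy => hneg y hy.2
  · refine ⟨hpos x hx', ?_⟩
    rw [primitive, zero_add] at hpa ⊢
    rw [← intervalIntegral.integral_add_adjacent_intervals
      (hc.intervalIntegrable 0 a) (hc.intervalIntegrable a x), hpa, zero_add,
      intervalIntegral.integral_of_le hx']
    exact setIntegral_eq_zero_of_forall_eq_zero fun y hy => hpos y hy.1.le

/-- The hypothesis puts h in the double orthogonal complement of span{1, x}, which is the span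
itself because it is finite dimensional. -/
theorem exists_ae_eq_affine {a : ℝ} {h : ℝ → ℂ} (hh : MemLp h 2 (volume.restrict (Icc 0 a)))
    (H : ∀ v : ℝ → ℂ, MemLp v 2 (volume.restrict (Icc 0 a)) → ∫ x in Icc 0 a, v x = 0 →
      ∫ x in Icc 0 a, (x : ℂ) * v x = 0 → ∫ x in Icc 0 a, inner ℂ (h x) (v x) = 0) :
    ∃ c0 c1 : ℂ, ∀ᵐ x ∂(volume.restrict (Icc 0 a)), h x = c0 + c1 * x := by
  set μ := volume.restrict (Icc 0 a) with hμ
  have m0 : MemLp (fun _ : ℝ => (1 : ℂ)) 2 μ := memLp_const 1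
  have m1 : MemLp (fun x : ℝ => (x : ℂ)) 2 μ := by
    refine MemLp.of_bound (by fun_prop) |a| ?_
    filter_upwards [ae_restrict_mem measurableSet_Icc] with x hx
    rw [Complex.norm_real, Real.norm_eq_abs, abs_of_nonneg hx.1]
    exact hx.2.trans (le_abs_self a)
  have key : hh.toLp ∈ (Submodule.span ℂ {m0.toLp, m1.toLp})ᗮᗮ := by
    rw [Submodule.mem_orthogonal']
    intro v hv
    have v0 := (Submodule.mem_orthogonal _ _).1 hv _ (Submodule.subset_span (mem_insert _ _))
    have v1 := (Submodule.mem_orthogonal _ _).1 hv _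
      (Submodule.subset_span (mem_insert_of_mem _ rfl))
    rw [L2.inner_def] at v0 v1 ⊢
    have e := H v (Lp.memLp v) (by
      rw [← v0]
      refine integral_congr_ae ?_
      filter_upwards [m0.coeFn_toLp] with x hx
      rw [hx]
      simp) (by
      rw [← v1]
      refine integral_congr_ae ?_
      filter_upwards [m1.coeFn_toLp] with x hx
      rw [hx]
      simp [mul_comm])
    rw [← e]
    refine integral_congr_ae ?_
    filter_upwards [hh.coeFn_toLp] with x hx
    rw [hx]
  have hfin : FiniteDimensional ℂ (Submodule.span ℂ {m0.toLp, m1.toLp}) :=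
    FiniteDimensional.span_of_finite ℂ (toFinite _)
  rw [Submodule.orthogonal_orthogonal, Submodule.mem_span_pair] at key
  obtain ⟨c0, c1, e⟩ := key
  refine ⟨c0, c1, ?_⟩
  filter_upwards [hh.coeFn_toLp, m0.coeFn_toLp, m1.coeFn_toLp,
    Lp.coeFn_add (c0 • m0.toLp) (c1 • m1.toLp), Lp.coeFn_smul c0 m0.toLp,
    Lp.coeFn_smul c1 m1.toLp] with x a1 a2 a3 a4 a5 a6
  rw [← a1, ← e, a4, Pi.add_apply, a5, a6, Pi.smul_apply, Pi.smul_apply, a2, a3]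
  simp

/-- The pair `(φ, χ)` belongs to the graph of the adjoint of the second derivative on the functions
with support in `[0, a]`. -/
def IsWeakSnd (I : Set ℝ) (a : ℝ) (φ χ : Lp ℂ 2 (volume.restrict I)) : Prop :=
  ∀ u w f g, IsRep I u w f g → (∀ x ∉ Ioo 0 a, f x = 0 ∧ g x = 0) → inner ℂ φ w = inner ℂ χ u

/-- Let Φ be a double primitive of χ. A function v orthogonal to the affine functions is F'' for an
F vanishing outside (0, a); the hypothesis gives ⟨φ, v⟩ = ⟨χ, F⟩ and Green's formula gives ⟨χ, F⟩ =
⟨Φ, v⟩. So φ − Φ is affine. -/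
theorem IsWeakSnd.ae_eq_primitive {I : Set ℝ} (hm : MeasurableSet I) {a : ℝ} (ha : 0 < a)
    (haI : Icc 0 a ⊆ I) {φ χ : Lp ℂ 2 (volume.restrict I)} (h : IsWeakSnd I a φ χ) :
    ∃ c0 c1 : ℂ, ∀ᵐ x ∂(volume.restrict (Icc 0 a)),
      φ x = primitive (primitive (I.indicator χ) c1) c0 x := by
  have hχ := locallyIntegrable_indicator hm (Lp.memLp χ)
  set X := I.indicator χ with hX
  set Φ := primitive (primitive X 0) 0 with hΦ
  have hΦc : Continuous Φ := continuous_primitive (continuous_primitive hχ 0).locallyIntegrable 0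
  have mφ : MemLp φ 2 (volume.restrict (Icc 0 a)) := memLp_restrict_mono haI (Lp.memLp φ)
  have mΦ : MemLp Φ 2 (volume.restrict (Icc 0 a)) := by
    obtain ⟨C, hC⟩ := (isCompact_Icc (a := (0:ℝ)) (b := a)).exists_bound_of_continuousOn hΦc.continuousOn
    refine MemLp.of_bound hΦc.aestronglyMeasurable C ?_
    filter_upwards [ae_restrict_mem measurableSet_Icc] with x hx using hC x hx
  obtain ⟨c0, c1, hc⟩ := exists_ae_eq_affine (a := a) (mφ.sub mΦ) (by
    intro v hv v0 v1
    have hW := locallyIntegrable_indicator measurableSet_Icc hv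
    set W := (Icc 0 a).indicator v with hWdef
    have hWv : ∀ x ∈ Icc 0 a, W x = v x := fun x hx => indicator_of_mem hx v
    have toSet : ∀ F : ℝ → ℂ, ∫ x in 0..a, F x = ∫ x in Icc 0 a, F x := fun F => by
      rw [intervalIntegral.integral_of_le ha.le, integral_Icc_eq_integral_Ioc]
    have hzero := fun x (hx : x ∉ Ioo 0 a) => primitive_eq_zero hW
      (fun x hx => indicator_of_notMem hx v)
      (by
        rw [toSet, ← v0]
        exact setIntegral_congr_fun measurableSet_Icc hWv)
      (by
        rw [toSet, ← v1]
        exact setIntegral_congr_fun measurableSet_Icc fun x hx => by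
          simp only [hWv x hx]) hx
    have hFc : Continuous (primitive (primitive W 0) 0) :=
      continuous_primitive (continuous_primitive hW 0).locallyIntegrable 0
    have mF : MemLp (primitive (primitive W 0) 0) 2 (volume.restrict I) := by
      refine hFc.memLp_of_hasCompactSupport (HasCompactSupport.intro isCompact_Icc
        (K := Icc 0 a) fun x hx => (hzero x fun hx' => hx (Ioo_subset_Icc_self hx')).2)
    have mW : MemLp W 2 (volume.restrict I) :=
      ((memLp_indicator_iff_restrict measurableSet_Icc).2 hv).restrict I
    have e := h mF.toLp mW.toLp _ _ (isRep_primitive hW 0 0 mW.coeFn_toLp mF.coeFn_toLp)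
      (fun x hx => ⟨(hzero x hx).2, (hzero x hx).1⟩)
    have restr : ∀ F : ℝ → ℂ, (∀ x ∉ Icc 0 a, F x = 0) →
        ∫ x in I, F x = ∫ x in Icc 0 a, F x := fun F hF =>
      setIntegral_eq_of_subset_of_forall_sdiff_eq_zero hm haI fun x hx => hF x hx.2
    have e1 : inner ℂ φ mW.toLp = ∫ x in Icc 0 a, inner ℂ (φ x) (v x) := by
      rw [L2.inner_def]
      calc _ = ∫ x in I, inner ℂ (φ x) (W x) := integral_congr_ae (by
              filter_upwards [mW.coeFn_toLp] with x hx
              rw [hx])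
        _ = ∫ x in Icc 0 a, inner ℂ (φ x) (W x) := restr _ fun x hx => by
              rw [hWdef, indicator_of_notMem hx, inner_zero_right]
        _ = _ := setIntegral_congr_fun measurableSet_Icc fun x hx => by
              simp only [hWv x hx]
    have e2 : inner ℂ χ mF.toLp =
        ∫ x in Icc 0 a, inner ℂ (X x) (primitive (primitive W 0) 0 x) := by
      rw [L2.inner_def]
      calc _ = ∫ x in I, inner ℂ (X x) (primitive (primitive W 0) 0 x) := integral_congr_ae (by
              filter_upwards [mF.coeFn_toLp, ae_restrict_mem hm] with x hx hx'
              rw [hx, hX, indicator_of_mem hx'])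
        _ = _ := restr _ fun x hx => by
              rw [(hzero x fun hx' => hx (Ioo_subset_Icc_self hx')).2, inner_zero_right]
    have e3 := (isSegRep_primitive hχ 0 0 0 a).green (isSegRep_primitive hW 0 0 0 a)
    have i1 : IntervalIntegrable (fun x => inner ℂ (X x) (primitive (primitive W 0) 0 x))
      volume 0 a := intervalIntegrable_inner (intervalIntegrable_of_locallyIntegrable hχ) hFc.continuousOn
    have i2 : IntervalIntegrable (fun x => inner ℂ (Φ x) (W x)) volume 0 a :=
      intervalIntegrable_inner' hΦc.continuousOn
        (intervalIntegrable_of_locallyIntegrable hW)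
    rw [intervalIntegral.integral_sub i1 i2, wronskian, wronskian, (hzero a (by simp)).1,
      (hzero a (by simp)).2, (hzero 0 (by simp)).1, (hzero 0 (by simp)).2, inner_zero_right,
      inner_zero_right, inner_zero_right, inner_zero_right, sub_self, toSet, toSet, sub_eq_zero] at e3
    have e4 : ∫ x in Icc 0 a, inner ℂ (Φ x) (W x) = ∫ x in Icc 0 a, inner ℂ (Φ x) (v x) :=
      setIntegral_congr_fun measurableSet_Icc fun x hx => by
        simp only [hWv x hx]
    simp only [Pi.sub_apply, inner_sub_left]
    rw [integral_sub (integrable_inner_of_memLp mφ hv) (integrable_inner_of_memLp mΦ hv), ← e1, e,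
      e2, e3, e4, sub_self])
  refine ⟨c0, c1, ?_⟩
  filter_upwards [hc] with x hx
  rw [primitive_primitive_add hχ, ← hx, Pi.sub_apply]
  ring

theorem IsWeakSnd.exists_isRep_Icc {a : ℝ} (ha : 0 < a) {φ χ : Lp ℂ 2 (volume.restrict (Icc 0 a))}
    (h : IsWeakSnd (Icc 0 a) a φ χ) : ∃ f g, IsRep (Icc 0 a) φ χ f g := by
  obtain ⟨c0, c1, hc⟩ := h.ae_eq_primitive measurableSet_Icc ha Subset.rfl
  exact ⟨_, _, isRep_primitive (locallyIntegrable_indicator measurableSet_Icc (Lp.memLp χ)) c0 c1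
    (indicator_ae_eq_restrict measurableSet_Icc).symm hc⟩

/-- The representations on [0, n + 1] have the same constants, since all these segments contain [0,
1], where an affine function is determined. -/
theorem IsWeakSnd.exists_isRep_Ici {φ χ : Lp ℂ 2 (volume.restrict (Ici (0 : ℝ)))}
    (h : ∀ a, 0 < a → IsWeakSnd (Ici 0) a φ χ) : ∃ f g, IsRep (Ici 0) φ χ f g := by
  have hχ := locallyIntegrable_indicator measurableSet_Ici (Lp.memLp χ)
  choose c0 c1 hc using fun n : ℕ => (h (n + 1) (by positivity)).ae_eq_primitive measurableSet_Ici
    (by positivity) Icc_subset_Ici_self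
  have hcont : ∀ n, Continuous (primitive (primitive ((Ici (0:ℝ)).indicator χ) (c1 n)) (c0 n)) :=
    fun n => continuous_primitive (continuous_primitive hχ _).locallyIntegrable _
  have heq : ∀ n, c0 n = c0 0 ∧ c1 n = c1 0 := by
    intro n
    have hsub : Icc (0 : ℝ) 1 ⊆ Icc 0 (n + 1) := Icc_subset_Icc_right (by simp)
    have h1 : EqOn (primitive (primitive ((Ici (0:ℝ)).indicator χ) (c1 n)) (c0 n))
        (primitive (primitive ((Ici (0:ℝ)).indicator χ) (c1 0)) (c0 0)) (Icc 0 1) := by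
      refine Measure.eqOn_Icc_of_ae_eq volume zero_ne_one ?_ (hcont n).continuousOn
        (hcont 0).continuousOn
      have h0 := hc 0
      simp only [Nat.cast_zero, zero_add] at h0
      filter_upwards [ae_restrict_of_ae_restrict_of_subset hsub (hc n), h0] with x a1 a2
      rw [← a1, ← a2]
    have e0 := h1 (left_mem_Icc.2 zero_le_one)
    have e1 := h1 (right_mem_Icc.2 zero_le_one)
    rw [primitive_zero, primitive_zero] at e0
    rw [primitive_primitive_add hχ, primitive_primitive_add hχ _ (c1 0), e0] at e1
    exact ⟨e0, by simpa using e1⟩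
  refine ⟨_, _, isRep_primitive hχ (c0 0) (c1 0)
    (indicator_ae_eq_restrict measurableSet_Ici).symm ?_⟩
  have hU : Ici (0 : ℝ) = ⋃ n : ℕ, Icc 0 ((n : ℝ) + 1) := by
    ext x
    simp only [mem_Ici, mem_iUnion, mem_Icc, exists_and_left]
    refine ⟨fun hx => ⟨hx, ?_⟩, fun hx => hx.1⟩
    obtain ⟨n, hn⟩ := exists_nat_ge x
    exact ⟨n, by linarith⟩
  have : ∀ᵐ x ∂(volume.restrict (⋃ n : ℕ, Icc 0 ((n : ℝ) + 1))),
      φ x = primitive (primitive ((Ici (0:ℝ)).indicator χ) (c1 0)) (c0 0) x := by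
    rw [ae_restrict_iUnion_iff]
    intro n
    have := hc n
    rwa [(heq n).1, (heq n).2] at this
  rwa [← hU] at this

/-! ### Functions with prescribed boundary data on one edge -/

theorem isRep_of_hasDerivAt {I : Set ℝ} {f g w : ℝ → ℂ} (hf : ∀ x, HasDerivAt f (g x) x)
    (hg : ∀ x, HasDerivAt g (w x) x) (hw : Continuous w) (mf : MemLp f 2 (volume.restrict I))
    (mw : MemLp w 2 (volume.restrict I)) : IsRep I mf.toLp mw.toLp f g := by
  have eg : primitive w (g 0) = g := by
    ext x
    rw [primitive, intervalIntegral.integral_eq_sub_of_hasDerivAt (fun y _ => hg y)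
      (hw.intervalIntegrable _ _)]
    ring
  have hgc : Continuous g := continuous_iff_continuousAt.2 fun x => (hg x).continuousAt
  have ef : primitive g (f 0) = f := by
    ext x
    rw [primitive, intervalIntegral.integral_eq_sub_of_hasDerivAt (fun y _ => hf y)
      (hgc.intervalIntegrable _ _)]
    ring
  have := isRep_primitive (I := I) hw.locallyIntegrable (f 0) (g 0) (u := mf.toLp) (w := mw.toLp)
    mw.coeFn_toLp (by rw [eg, ef]; exact mf.coeFn_toLp)
  rwa [eg, ef] at this

theorem exists_isRep_Icc_boundary {a : ℝ} (ha : 0 < a) (c0 c1 d0 d1 : ℂ) :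
    ∃ u w f g, IsRep (Icc 0 a) u w f g ∧ f 0 = c0 ∧ g 0 = c1 ∧ f a = d0 ∧ g a = d1 := by
  have ha' : (a : ℂ) ≠ 0 := Complex.ofReal_ne_zero.2 ha.ne'
  -- Cubic Hermite interpolation: p and q solve the two conditions at a.
  set p : ℂ := (3 * (d0 - c0 - c1 * a) - a * (d1 - c1)) / a ^ 2 with hp
  set q : ℂ := (a * (d1 - c1) - 2 * (d0 - c0 - c1 * a)) / a ^ 3 with hq
  have hd : ∀ x : ℝ, HasDerivAt (fun x : ℝ => (x : ℂ)) 1 x := fun x =>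
    Complex.ofRealCLM.hasDerivAt
  have bdd : ∀ h : ℝ → ℂ, Continuous h → MemLp h 2 (volume.restrict (Icc 0 a)) := fun h hh => by
    obtain ⟨C, hC⟩ := (isCompact_Icc (a := (0:ℝ)) (b := a)).exists_bound_of_continuousOn
      hh.continuousOn
    refine MemLp.of_bound hh.aestronglyMeasurable C ?_
    filter_upwards [ae_restrict_mem measurableSet_Icc] with x hx using hC x hx
  refine ⟨_, _, fun x => c0 + c1 * x + p * x ^ 2 + q * x ^ 3,
    fun x => c1 + 2 * p * x + 3 * q * x ^ 2,
    isRep_of_hasDerivAt (w := fun x => 2 * p + 6 * q * x) (fun x => ?_) (fun x => ?_)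
      (by fun_prop) (bdd _ (by fun_prop)) (bdd _ (by fun_prop)), ?_, ?_, ?_, ?_⟩
  · refine ((((hd x).const_mul c1).const_add c0).add (((hd x).pow 2).const_mul p) |>.add
      (((hd x).pow 3).const_mul q)).congr_deriv ?_
    push_cast
    ring
  · refine ((((hd x).const_mul (2 * p)).const_add c1).add
      (((hd x).pow 2).const_mul (3 * q))).congr_deriv ?_
    push_cast
    ring
  · simp
  · simp
  · simp only [hp, hq]
    field_simp
    ring
  · simp only [hp, hq]
    field_simp
    ring

theorem exists_isRep_Ici_boundary (c0 c1 : ℂ) :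
    ∃ u w f g, IsRep (Ici 0) u w f g ∧ f 0 = c0 ∧ g 0 = c1 := by
  have hd : ∀ k x : ℝ, HasDerivAt (fun x : ℝ => ((Real.exp (-k * x) : ℝ) : ℂ))
      (-k * (Real.exp (-k * x) : ℝ)) x := fun k x => by
    have h1 : HasDerivAt (fun x : ℝ => Real.exp (-k * x)) (Real.exp (-k * x) * (-k * 1)) x :=
      ((hasDerivAt_id x).const_mul (-k)).exp
    refine h1.ofReal_comp.congr_deriv ?_
    push_cast
    ring
  have hm : ∀ k : ℝ, 0 < k → MemLp (fun x : ℝ => ((Real.exp (-k * x) : ℝ) : ℂ)) 2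
      (volume.restrict (Ici 0)) := fun k hk => by
    rw [memLp_two_iff_integrable_sq_norm (by fun_prop)]
    have h1 : IntegrableOn (fun x : ℝ => Real.exp (-(2 * k) * x)) (Ici 0) :=
      (integrableOn_Ici_iff_integrableOn_Ioi (by simp)).2 (exp_neg_integrableOn_Ioi 0 (by positivity))
    refine h1.congr (Eventually.of_forall fun x => ?_)
    simp only [Complex.norm_real, Real.norm_eq_abs, Real.abs_exp, ← Real.exp_nat_mul]
    congr 1
    push_cast
    ring
  -- For αe^{-x} + βe^{-2x} the conditions α + β = c0 and −α − 2β = c1 give these coefficients.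
  refine ⟨_, _, fun x => (2 * c0 + c1) * (Real.exp (-(1 : ℝ) * x) : ℝ) +
      -(c0 + c1) * (Real.exp (-(2 : ℝ) * x) : ℝ),
    fun x => -(2 * c0 + c1) * (Real.exp (-(1 : ℝ) * x) : ℝ) +
      (2 * (c0 + c1)) * (Real.exp (-(2 : ℝ) * x) : ℝ),
    isRep_of_hasDerivAt (w := fun x => (2 * c0 + c1) * (Real.exp (-(1 : ℝ) * x) : ℝ) +
      -(4 * (c0 + c1)) * (Real.exp (-(2 : ℝ) * x) : ℝ)) (fun x => ?_) (fun x => ?_)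
      (by fun_prop) (((hm 1 one_pos).const_mul _).add ((hm 2 two_pos).const_mul _))
      (((hm 1 one_pos).const_mul _).add ((hm 2 two_pos).const_mul _)), ?_, ?_⟩
  · refine (((hd 1 x).const_mul _).add ((hd 2 x).const_mul _)).congr_deriv ?_
    push_cast
    ring
  · refine (((hd 1 x).const_mul _).add ((hd 2 x).const_mul _)).congr_deriv ?_
    push_cast
    ring
  · simp
    ring
  · simp
    ring

/-! ### The maximal and minimal operators on the graph -/

section

set_option linter.unusedSectionVars false

variable {V Ep Em Ip Im : Type*} (G : SignedMetricGraph V Ep Em Ip Im)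

theorem sign_mul_self (j : Edge Ep Em Ip Im) : sign j * sign j = 1 := by
  rcases j with (j | j) | (j | j) <;> simp [sign]

theorem conj_sign (j : Edge Ep Em Ip Im) : starRingEnd ℂ (sign j) = sign j := by
  rcases j with (j | j) | (j | j) <;> simp [sign]

variable [Fintype Ep] [Fintype Em] [Fintype Ip] [Fintype Im]

/-- The function on the graph with given components in `𝒟_j` is in `𝒟`; its values, derivatives
and its image under `T^max` are the expected ones. -/
theorem mem_D_of_isRep {ψ : G.H} {w : ∀ j, Lp ℂ 2 (volume.restrict (G.interval j))}
    {f g : Edge Ep Em Ip Im → ℝ → ℂ} (h : ∀ j, IsRep (G.interval j) (ψ j) (w j) (f j) (g j)) :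
    ∃ hψ : ψ ∈ G.D, (∀ j x hx, G.value j x hx ⟨ψ, hψ⟩ = f j x) ∧
      (∀ j x hx, G.deriv j x hx ⟨ψ, hψ⟩ = g j x) ∧
      ∀ j, (G.Tmax ⟨ψ, hψ⟩) j = -sign j • w j := by
  have hψ : ψ ∈ G.D := fun j => ⟨_, _, _, h j⟩
  have hu := fun j => IsRep.unique' G (edgeD_isRep (G.comp j ⟨ψ, hψ⟩)) (h j)
  refine ⟨hψ, fun j x hx => (hu j).1 hx, fun j x hx => (hu j).2.1 hx, fun j => ?_⟩
  rw [← (hu j).2.2]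
  rfl

theorem isRep_comp (ψ : G.D) (j : Edge Ep Em Ip Im) :
    IsRep (G.interval j) (ψ.1 j) (edgeD_snd (G.comp j ψ)) (edgeD_rep (G.comp j ψ))
      (edgeD_der (G.comp j ψ)) :=
  edgeD_isRep (G.comp j ψ)

theorem Tmax_apply (ψ : G.D) (j : Edge Ep Em Ip Im) :
    (G.Tmax ψ) j = -sign j • edgeD_snd (G.comp j ψ) := rfl

/-- Data for a function on the graph supported on one edge. -/
theorem isRep_single [DecidableEq (Edge Ep Em Ip Im)] {j : Edge Ep Em Ip Im}
    {u w : Lp ℂ 2 (volume.restrict (G.interval j))}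
    {f g : ℝ → ℂ} (h : IsRep (G.interval j) u w f g) (k : Edge Ep Em Ip Im) :
    IsRep (G.interval k) ((Pi.single j u : ∀ k, Lp ℂ 2 (volume.restrict (G.interval k))) k)
      ((Pi.single j w : ∀ k, Lp ℂ 2 (volume.restrict (G.interval k))) k)
      ((Pi.single j f : Edge Ep Em Ip Im → ℝ → ℂ) k)
      ((Pi.single j g : Edge Ep Em Ip Im → ℝ → ℂ) k) := by
  rcases eq_or_ne k j with rfl | hk
  · simpa using h
  · simp only [Pi.single_eq_of_ne hk]
    exact IsRep.zero _

theorem D0_le_D : G.D0 ≤ G.D := fun _ h => h.1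

/-- The adjoint of `T^min` is contained in `T^max`. -/
theorem mem_D_of_forall_D0 {φ χ : G.H}
    (h : ∀ ψ (hψ : ψ ∈ G.D0), inner ℂ φ (G.Tmax ⟨ψ, G.D0_le_D hψ⟩) = inner ℂ χ ψ) :
    ∃ hφ : φ ∈ G.D, G.Tmax ⟨φ, hφ⟩ = χ := by
  classical
  -- Testing with functions supported on a single edge decouples the edges.
  have key : ∀ j u w f g, IsRep (G.interval j) u w f g → f 0 = 0 → g 0 = 0 →
      (∀ i, j = .inr i → f (G.len i) = 0 ∧ g (G.len i) = 0) →
      inner ℂ (φ j) w = inner ℂ (-sign j • χ j) u := by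
    intro j u w f g hr hf hg hi
    set ψ : G.H := WithLp.toLp 2 (Pi.single j u)
    obtain ⟨hψ, hv, hd, hT⟩ := G.mem_D_of_isRep (ψ := ψ) (G.isRep_single hr)
    have hψ0 : ψ ∈ G.D0 := by
      refine ⟨hψ, fun k => ?_, fun i => ?_⟩
      · rw [hv, hd]
        rcases eq_or_ne k j with rfl | hk
        · simp [hf, hg]
        · simp [Pi.single_eq_of_ne hk]
      · rw [hv, hd]
        by_cases hk : (.inr i : Edge Ep Em Ip Im) = j
        · subst hk
          simp [hi i rfl]
        · simp [Pi.single_eq_of_ne hk]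
    have e := h ψ hψ0
    rw [PiLp.inner_apply, PiLp.inner_apply, Finset.sum_eq_single j, Finset.sum_eq_single j, hT] at e
    · simp only [ψ, Pi.single_eq_same] at e
      rw [inner_smul_right] at e
      rw [inner_smul_left, map_neg, conj_sign, ← e, ← mul_assoc, neg_mul_neg, sign_mul_self,
        one_mul]
    · intro k _ hk
      simp [ψ, Pi.single_eq_of_ne hk]
    · simp
    · intro k _ hk
      rw [hT]
      simp [Pi.single_eq_of_ne hk]
    · simp
  have hrep : ∀ j, ∃ f g, IsRep (G.interval j) (φ j) (-sign j • χ j) f g := by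
    rintro (j | j)
    · refine IsWeakSnd.exists_isRep_Ici fun a _ u w f g hr h0 => ?_
      exact key (.inl j) u w f g hr (h0 0 (by simp)).1 (h0 0 (by simp)).2 (by simp)
    · refine IsWeakSnd.exists_isRep_Icc (G.len_pos j) fun u w f g hr h0 => ?_
      refine key (.inr j) u w f g hr (h0 0 (by simp)).1 (h0 0 (by simp)).2 fun i hi => ?_
      cases hi
      exact h0 _ (by simp)
  choose f g hfg using hrep
  obtain ⟨hφ, -, -, hT⟩ := G.mem_D_of_isRep hfg
  refine ⟨hφ, ?_⟩
  ext j : 1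
  rw [hT, smul_smul, neg_mul_neg, sign_mul_self, one_smul]

/-- If χ is orthogonal to `D0`, then (0, χ) satisfies the adjoint relation, so χ = `Tmax` 0 = 0. -/
theorem dense_D0 : Dense (G.D0 : Set G.H) := by
  rw [Submodule.dense_iff_topologicalClosure_eq_top, Submodule.topologicalClosure_eq_top_iff,
    Submodule.eq_bot_iff]
  intro χ hχ
  obtain ⟨h0, hT⟩ := G.mem_D_of_forall_D0 (φ := 0) (χ := χ) fun ψ hψ => by
    rw [inner_zero_left, (Submodule.mem_orthogonal' _ _).1 hχ ψ hψ]
  rw [← hT]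
  exact map_zero G.Tmax.toFun

/-! ### Boundary values and Green's formula on the graph -/

section BoundaryValues

variable [DecidableEq Ep] [DecidableEq Em] [DecidableEq Ip] [DecidableEq Im]

theorem bv_eq (ψ : G.D) : (G.bv ψ).ofLp = Sum.elim
    (Sum.elim
      (Sum.elim (fun e => edgeD_rep (G.comp (.inl (.inl e)) ψ) 0)
        (Sum.elim (fun i => edgeD_rep (G.comp (.inr (.inl i)) ψ) 0)
          (fun i => edgeD_rep (G.comp (.inr (.inl i)) ψ) (G.len (.inl i)))))
      (Sum.elim (fun e => edgeD_rep (G.comp (.inl (.inr e)) ψ) 0)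
        (Sum.elim (fun i => edgeD_rep (G.comp (.inr (.inr i)) ψ) 0)
          (fun i => edgeD_rep (G.comp (.inr (.inr i)) ψ) (G.len (.inr i))))))
    (Sum.elim
      (Sum.elim (fun e => edgeD_der (G.comp (.inl (.inl e)) ψ) 0)
        (Sum.elim (fun i => edgeD_der (G.comp (.inr (.inl i)) ψ) 0)
          (fun i => -edgeD_der (G.comp (.inr (.inl i)) ψ) (G.len (.inl i)))))
      (Sum.elim (fun e => edgeD_der (G.comp (.inl (.inr e)) ψ) 0)
        (Sum.elim (fun i => edgeD_der (G.comp (.inr (.inr i)) ψ) 0)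
          (fun i => -edgeD_der (G.comp (.inr (.inr i)) ψ) (G.len (.inr i)))))) := by
  ext (((e | i | i) | (e | i | i)) | ((e | i | i) | (e | i | i))) <;> rfl

/-- The boundary term of Green's formula on one edge. -/
noncomputable def edgeWronskian (ψ φ : G.D) (j : Edge Ep Em Ip Im) : ℝ → ℂ :=
  wronskian (edgeD_rep (G.comp j ψ)) (edgeD_der (G.comp j ψ)) (edgeD_rep (G.comp j φ))
    (edgeD_der (G.comp j φ))

/-- The inward orientation of derivatives produces the minus sign at the far end of an internal
edge, and J produces the sign of the edge. -/
theorem symplecticForm_bv (ψ φ : G.D) : symplecticForm (G.bv ψ) (G.bv φ) =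
    ∑ e, sign (.inl e : Edge Ep Em Ip Im) * G.edgeWronskian ψ φ (.inl e) 0 +
      ∑ i, sign (.inr i : Edge Ep Em Ip Im) *
        (G.edgeWronskian ψ φ (.inr i) 0 - G.edgeWronskian ψ φ (.inr i) (G.len i)) := by
  have hW : ∀ j x, G.edgeWronskian ψ φ j x =
      starRingEnd ℂ (edgeD_der (G.comp j ψ) x) * edgeD_rep (G.comp j φ) x -
        starRingEnd ℂ (edgeD_rep (G.comp j ψ) x) * edgeD_der (G.comp j φ) x := fun j x => by
    rw [mul_comm, mul_comm (starRingEnd ℂ _)]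
    rfl
  rw [symplecticForm_eq]
  simp only [bv_eq, Sum.elim_inl, Sum.elim_inr, Fintype.sum_sum_type, hW, sign, map_neg, neg_mul,
    mul_neg, one_mul, Finset.sum_sub_distrib, Finset.sum_neg_distrib]
  ring

theorem green (ψ φ : G.D) : inner ℂ (G.Tmax ψ) (φ : G.H) - inner ℂ (ψ : G.H) (G.Tmax φ) =
    symplecticForm (G.bv ψ) (G.bv φ) := by
  have hj : ∀ j, inner ℂ ((G.Tmax ψ) j) ((φ : G.H) j) - inner ℂ ((ψ : G.H) j) ((G.Tmax φ) j) =
      -sign j * (inner ℂ (edgeD_snd (G.comp j ψ)) ((φ : G.H) j) -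
        inner ℂ ((ψ : G.H) j) (edgeD_snd (G.comp j φ))) := fun j => by
    rw [Tmax_apply, Tmax_apply, inner_smul_left, inner_smul_right, map_neg, conj_sign, mul_sub]
  have hext : ∀ e, inner ℂ (edgeD_snd (G.comp (.inl e) ψ)) ((φ : G.H) (.inl e)) -
      inner ℂ ((ψ : G.H) (.inl e)) (edgeD_snd (G.comp (.inl e) φ)) =
        -G.edgeWronskian ψ φ (.inl e) 0 := fun e =>
    IsRep.green_Ici (G.isRep_comp ψ (.inl e)) (G.isRep_comp φ (.inl e))
  have hint : ∀ i, inner ℂ (edgeD_snd (G.comp (.inr i) ψ)) ((φ : G.H) (.inr i)) -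
      inner ℂ ((ψ : G.H) (.inr i)) (edgeD_snd (G.comp (.inr i) φ)) =
        G.edgeWronskian ψ φ (.inr i) (G.len i) - G.edgeWronskian ψ φ (.inr i) 0 := fun i =>
    IsRep.green_Icc (G.len_pos i) (G.isRep_comp ψ (.inr i)) (G.isRep_comp φ (.inr i))
  rw [PiLp.inner_apply, PiLp.inner_apply, ← Finset.sum_sub_distrib,
    Finset.sum_congr rfl fun j _ => hj j, symplecticForm_bv, Fintype.sum_sum_type]
  refine congrArg₂ _ (Finset.sum_congr rfl fun e _ => ?_) (Finset.sum_congr rfl fun i _ => ?_)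
  · rw [hext]
    ring
  · rw [hint]
    ring

theorem bv_surjective : Function.Surjective G.bv := by
  intro η
  let c0 : Edge Ep Em Ip Im → ℂ := fun
    | .inl (.inl e) => η (.inl (.inl (.inl e)))
    | .inl (.inr e) => η (.inl (.inr (.inl e)))
    | .inr (.inl i) => η (.inl (.inl (.inr (.inl i))))
    | .inr (.inr i) => η (.inl (.inr (.inr (.inl i))))
  let c1 : Edge Ep Em Ip Im → ℂ := fun
    | .inl (.inl e) => η (.inr (.inl (.inl e)))
    | .inl (.inr e) => η (.inr (.inr (.inl e)))
    | .inr (.inl i) => η (.inr (.inl (.inr (.inl i))))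
    | .inr (.inr i) => η (.inr (.inr (.inr (.inl i))))
  let d0 : Ip ⊕ Im → ℂ := fun
    | .inl i => η (.inl (.inl (.inr (.inr i))))
    | .inr i => η (.inl (.inr (.inr (.inr i))))
  -- Negated because `bv` records the inward derivative at the far end.
  let d1 : Ip ⊕ Im → ℂ := fun
    | .inl i => -η (.inr (.inl (.inr (.inr i))))
    | .inr i => -η (.inr (.inr (.inr (.inr i))))
  have H : ∀ j, ∃ u w f g, IsRep (G.interval j) u w f g ∧ f 0 = c0 j ∧ g 0 = c1 j ∧
      ∀ i, j = .inr i → f (G.len i) = d0 i ∧ g (G.len i) = d1 i := by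
    rintro (j | j)
    · obtain ⟨u, w, f, g, h, h0, h1⟩ := exists_isRep_Ici_boundary (c0 (.inl j)) (c1 (.inl j))
      exact ⟨u, w, f, g, h, h0, h1, by simp⟩
    · obtain ⟨u, w, f, g, h, h0, h1, h2, h3⟩ := exists_isRep_Icc_boundary (G.len_pos j)
        (c0 (.inr j)) (c1 (.inr j)) (d0 j) (d1 j)
      refine ⟨u, w, f, g, h, h0, h1, fun i hi => ?_⟩
      cases hi
      exact ⟨h2, h3⟩
  choose u w f g hr h0 h1 h2 using H
  obtain ⟨hψ, hv, hd, -⟩ := G.mem_D_of_isRep (ψ := WithLp.toLp 2 u) hr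
  have v0 : ∀ j, G.value j 0 (G.zero_mem j) ⟨_, hψ⟩ = c0 j := fun j => (hv j _ _).trans (h0 j)
  have g0 : ∀ j, G.deriv j 0 (G.zero_mem j) ⟨_, hψ⟩ = c1 j := fun j => (hd j _ _).trans (h1 j)
  have va : ∀ i, G.value (.inr i) (G.len i) (G.len_mem i) ⟨_, hψ⟩ = d0 i := fun i =>
    (hv _ _ _).trans (h2 _ i rfl).1
  have ga : ∀ i, -G.deriv (.inr i) (G.len i) (G.len_mem i) ⟨_, hψ⟩ = -d1 i := fun i =>
    congrArg Neg.neg ((hd _ _ _).trans (h2 _ i rfl).2)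
  refine ⟨⟨_, hψ⟩, ?_⟩
  ext (((e | i | i) | (e | i | i)) | ((e | i | i) | (e | i | i)))
  · exact v0 _
  · exact v0 _
  · exact va _
  · exact v0 _
  · exact v0 _
  · exact va _
  · exact g0 _
  · exact g0 _
  · exact (ga _).trans (neg_neg _)
  · exact g0 _
  · exact g0 _
  · exact (ga _).trans (neg_neg _)

theorem mem_D0_iff {ψ : G.H} : ψ ∈ G.D0 ↔ ∃ h : ψ ∈ G.D, G.bv ⟨ψ, h⟩ = 0 := by
  constructor
  · rintro ⟨h, h0, h1⟩
    refine ⟨h, ?_⟩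
    ext (((e | i | i) | (e | i | i)) | ((e | i | i) | (e | i | i)))
    · exact (h0 _).1
    · exact (h0 _).1
    · exact (h1 _).1
    · exact (h0 _).1
    · exact (h0 _).1
    · exact (h1 _).1
    · exact (h0 _).2
    · exact (h0 _).2
    · exact neg_eq_zero.2 (h1 _).2
    · exact (h0 _).2
    · exact (h0 _).2
    · exact neg_eq_zero.2 (h1 _).2
  · rintro ⟨h, hb⟩
    have hk := fun k => congrFun (congrArg WithLp.ofLp hb) k
    refine ⟨h, ?_, ?_⟩
    · rintro ((e | e) | (i | i))
      · exact ⟨hk (.inl (.inl (.inl e))), hk (.inr (.inl (.inl e)))⟩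
      · exact ⟨hk (.inl (.inr (.inl e))), hk (.inr (.inr (.inl e)))⟩
      · exact ⟨hk (.inl (.inl (.inr (.inl i)))), hk (.inr (.inl (.inr (.inl i))))⟩
      · exact ⟨hk (.inl (.inr (.inr (.inl i)))), hk (.inr (.inr (.inr (.inl i))))⟩
    · rintro (i | i)
      · exact ⟨hk (.inl (.inl (.inr (.inr i)))), neg_eq_zero.1 (hk (.inr (.inl (.inr (.inr i)))))⟩
      · exact ⟨hk (.inl (.inr (.inr (.inr i)))), neg_eq_zero.1 (hk (.inr (.inr (.inr (.inr i)))))⟩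

/-! ### Self-adjoint extensions as subspaces of boundary values -/

theorem domOf_le_D (M : Submodule ℂ (K2 Ep Em Ip Im)) : G.domOf M ≤ G.D := fun _ h => h.1

theorem D0_le_domOf (M : Submodule ℂ (K2 Ep Em Ip Im)) : G.D0 ≤ G.domOf M := fun _ hψ => by
  obtain ⟨h, h0⟩ := G.mem_D0_iff.1 hψ
  exact ⟨h, h0 ▸ M.zero_mem⟩

theorem opOf_domain (M : Submodule ℂ (K2 Ep Em Ip Im)) : (G.opOf M).domain = G.domOf M :=
  inf_eq_left.2 (G.domOf_le_D M)

theorem Tmin_domain : G.Tmin.domain = G.D0 := inf_eq_left.2 G.D0_le_D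

theorem mem_opOf_domain {M : Submodule ℂ (K2 Ep Em Ip Im)} {ψ : G.D} :
    (ψ : G.H) ∈ (G.opOf M).domain ↔ G.bv ψ ∈ M := by
  rw [opOf_domain]
  exact ⟨fun h => h.2, fun h => ⟨ψ.2, h⟩⟩

theorem opOf_injective : Function.Injective G.opOf := by
  intro M N h
  ext ξ
  obtain ⟨ψ, rfl⟩ := G.bv_surjective ξ
  rw [← mem_opOf_domain, ← mem_opOf_domain, h]

theorem opOf_le_Tmax (M : Submodule ℂ (K2 Ep Em Ip Im)) : G.opOf M ≤ G.Tmax :=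
  LinearPMap.domRestrict_le

theorem Tmin_le_Tmax : G.Tmin ≤ G.Tmax := LinearPMap.domRestrict_le

theorem le_of_le_Tmax {S T : G.H →ₗ.[ℂ] G.H} (hS : S ≤ G.Tmax) (hT : T ≤ G.Tmax)
    (h : S.domain ≤ T.domain) : S ≤ T :=
  ⟨h, fun x _ hxy => (hS.2 (y := ⟨x, hS.1 x.2⟩) rfl).trans
    (hT.2 (y := ⟨x, hS.1 x.2⟩) hxy.symm).symm⟩

theorem Tmin_le_opOf (M : Submodule ℂ (K2 Ep Em Ip Im)) : G.Tmin ≤ G.opOf M := by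
  refine G.le_of_le_Tmax G.Tmin_le_Tmax (G.opOf_le_Tmax M) ?_
  rw [Tmin_domain, opOf_domain]
  exact G.D0_le_domOf M

/-- The operators between `T^min` and `T^max` are given by subspaces of `𝒦²`. -/
theorem exists_eq_opOf {T : G.H →ₗ.[ℂ] G.H} (h1 : G.Tmin ≤ T) (h2 : T ≤ G.Tmax) :
    ∃ M, T = G.opOf M := by
  have hdom : ∀ x ∈ G.D0, x ∈ T.domain := fun x hx => h1.1 (by rwa [Tmin_domain])
  refine ⟨(T.domain.comap G.D.subtype).map G.bv, ?_⟩
  refine le_antisymm (G.le_of_le_Tmax h2 (G.opOf_le_Tmax _) fun x hx => ?_)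
    (G.le_of_le_Tmax (G.opOf_le_Tmax _) h2 fun x hx => ?_)
  · rw [opOf_domain]
    exact ⟨h2.1 hx, ⟨x, h2.1 hx⟩, hx, rfl⟩
  · rw [opOf_domain] at hx
    obtain ⟨hxD, y, hy, e⟩ := hx
    -- Equal boundary values differ by an element of `D0`, which already lies in the domain of T.
    have h0 : x - y ∈ G.D0 := G.mem_D0_iff.2 ⟨G.D.sub_mem hxD y.2, by
      have := map_sub G.bv ⟨x, hxD⟩ y
      rwa [e, sub_self] at this⟩
    have := T.domain.add_mem (hdom _ h0) hy
    simpa using this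

theorem opOf_apply {M : Submodule ℂ (K2 Ep Em Ip Im)} (x : (G.opOf M).domain) :
    G.opOf M x = G.Tmax ⟨x, (G.opOf_le_Tmax M).1 x.2⟩ :=
  (G.opOf_le_Tmax M).2 rfl

theorem dense_opOf_domain (M : Submodule ℂ (K2 Ep Em Ip Im)) :
    Dense ((G.opOf M).domain : Set G.H) := by
  rw [opOf_domain]
  exact G.dense_D0.mono (G.D0_le_domOf M)

open LinearPMap in
-- By Green's formula, membership of φ ∈ 𝒟 in the adjoint domain means that [φ] is in the symplectic
-- complement of M. Adjoint vectors do lie in 𝒟, because the domain contains `D0`.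
theorem isSelfAdjoint_opOf_iff (M : Submodule ℂ (K2 Ep Em Ip Im)) :
    IsSelfAdjoint (G.opOf M) ↔ IsMaximalIsotropic M := by
  have hd := G.dense_opOf_domain M
  rw [isMaximalIsotropic_iff]
  constructor
  · intro hsa η
    rw [LinearPMap.isSelfAdjoint_def] at hsa
    have hform := LinearPMap.adjoint_isFormalAdjoint hd
    rw [hsa] at hform
    obtain ⟨φ, rfl⟩ := G.bv_surjective η
    constructor
    · intro hφ ξ hξ
      obtain ⟨ψ, rfl⟩ := G.bv_surjective ξ
      have e := hform ⟨ψ, G.mem_opOf_domain.2 hξ⟩ ⟨φ, G.mem_opOf_domain.2 hφ⟩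
      rw [opOf_apply, opOf_apply] at e
      rw [← green, sub_eq_zero]
      exact e
    · intro h
      -- By Green's formula `Tmax` φ serves as the adjoint image, so φ is in the adjoint domain,
      -- which is the domain itself.
      rw [← mem_opOf_domain, ← hsa]
      refine LinearPMap.mem_adjoint_domain_of_exists _ ⟨G.Tmax φ, fun x => ?_⟩
      rw [opOf_apply]
      set ψ : G.D := ⟨x, (G.opOf_le_Tmax M).1 x.2⟩
      have e := G.green ψ φ
      rw [h _ (G.mem_opOf_domain.1 x.2), sub_eq_zero] at e
      rw [← inner_conj_symm, ← inner_conj_symm (φ : G.H)]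
      exact congrArg _ e.symm
  · intro hM
    rw [LinearPMap.isSelfAdjoint_def]
    refine le_antisymm ?_ (LinearPMap.IsFormalAdjoint.le_adjoint hd fun x y => ?_)
    · have hform := LinearPMap.adjoint_isFormalAdjoint hd
      have key : ∀ x : (G.opOf M)†.domain, ∃ hx : (x : G.H) ∈ G.D,
          G.Tmax ⟨x, hx⟩ = (G.opOf M)† x := fun x =>
        G.mem_D_of_forall_D0 fun ψ hψ => by
          have e := hform x ⟨ψ, by rw [opOf_domain]; exact G.D0_le_domOf M hψ⟩
          rw [opOf_apply] at e
          exact e.symm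
      refine G.le_of_le_Tmax ⟨fun x hx => (key ⟨x, hx⟩).1, fun x y hxy => ?_⟩ (G.opOf_le_Tmax M)
        fun x hx => ?_
      · obtain ⟨hx, e⟩ := key x
        rw [← e]
        congr 1
        exact Subtype.ext hxy
      · obtain ⟨hxD, e⟩ := key ⟨x, hx⟩
        refine (G.mem_opOf_domain (ψ := ⟨x, hxD⟩)).2 ((hM _).2 fun ξ hξ => ?_)
        obtain ⟨ψ, rfl⟩ := G.bv_surjective ξ
        have e1 := hform ⟨x, hx⟩ ⟨ψ, G.mem_opOf_domain.2 hξ⟩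
        rw [opOf_apply, ← e] at e1
        rw [← green, sub_eq_zero, ← inner_conj_symm, ← inner_conj_symm (ψ : G.H)]
        exact congrArg _ e1.symm
    · rw [opOf_apply, opOf_apply]
      have e := G.green ⟨x, (G.opOf_le_Tmax M).1 x.2⟩ ⟨y, (G.opOf_le_Tmax M).1 y.2⟩
      rwa [(hM _).1 (G.mem_opOf_domain.1 y.2) _ (G.mem_opOf_domain.1 x.2), sub_eq_zero] at e

/-- T is its own adjoint, and the adjoint relation tested only on `D0` already places its graph in
that of `Tmax`. -/
theorem le_Tmax_of_isSelfAdjoint {T : G.H →ₗ.[ℂ] G.H} (h : G.Tmin ≤ T) (hT : IsSelfAdjoint T) :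
    T ≤ G.Tmax := by
  have hform := LinearPMap.adjoint_isFormalAdjoint hT.dense_domain
  rw [LinearPMap.isSelfAdjoint_def.1 hT] at hform
  have key : ∀ x : T.domain, ∃ hx : (x : G.H) ∈ G.D, G.Tmax ⟨x, hx⟩ = T x := fun x =>
    G.mem_D_of_forall_D0 fun ψ hψ => by
      have hψ' : ψ ∈ G.Tmin.domain := by rwa [Tmin_domain]
      have e := hform x ⟨ψ, h.1 hψ'⟩
      rw [← h.2 (x := ⟨ψ, hψ'⟩) (y := ⟨ψ, h.1 hψ'⟩) rfl, G.Tmin_le_Tmax.2 (y := ⟨ψ, G.D0_le_D hψ⟩) rfl] at e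
      exact e.symm
  refine ⟨fun x hx => (key ⟨x, hx⟩).1, fun x y hxy => ?_⟩
  obtain ⟨hx, e⟩ := key x
  rw [← e]
  congr 1
  exact Subtype.ext hxy

theorem bijOn_opOf : BijOn G.opOf
    {M : Submodule ℂ (K2 Ep Em Ip Im) | IsMaximalIsotropic M}
    {T : G.H →ₗ.[ℂ] G.H | G.Tmin ≤ T ∧ IsSelfAdjoint T} := by
  refine ⟨fun M hM => ⟨G.Tmin_le_opOf M, (G.isSelfAdjoint_opOf_iff M).2 hM⟩,
    G.opOf_injective.injOn, fun T hT => ?_⟩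
  obtain ⟨M, rfl⟩ := G.exists_eq_opOf hT.1 (G.le_Tmax_of_isSelfAdjoint hT.1 hT.2)
  exact ⟨M, (G.isSelfAdjoint_opOf_iff M).1 hT.2, rfl⟩

theorem opAB_eq_opOf (A B : Matrix (Index Ep Em Ip Im) (Index Ep Em Ip Im) ℂ) :
    G.opAB A B = G.opOf (kerAB A B) := by
  rw [opAB, opOf]
  congr 1
  ext ψ
  refine exists_congr fun h => ?_
  have e : Matrix.fromCols A B *ᵥ (G.bv ⟨ψ, h⟩).ofLp = G.abMap A B ⟨ψ, h⟩ :=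
    Matrix.fromCols_mulVec_sumElim _ _ _ _
  rw [mem_kerAB, e]

end BoundaryValues

end

end SignedMetricGraph

theorem theorem3p1 {V Ep Em Ip Im : Type*} [Fintype V]
    [Fintype Ep] [Fintype Em] [Fintype Ip] [Fintype Im]
    [DecidableEq Ep] [DecidableEq Em] [DecidableEq Ip] [DecidableEq Im]
    (G : SignedMetricGraph V Ep Em Ip Im) :
    -- Maximal isotropic subspaces correspond bijectively to self-adjoint extensions.
    Set.BijOn G.opOf
      {M : Submodule ℂ (SignedMetricGraph.K2 Ep Em Ip Im) |
        SignedMetricGraph.IsMaximalIsotropic M}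
      {T : G.H →ₗ.[ℂ] G.H | G.Tmin ≤ T ∧ IsSelfAdjoint T} ∧
    -- The maximal isotropic subspaces are exactly the kernels of admissible pairs.
    (∀ M : Submodule ℂ (SignedMetricGraph.K2 Ep Em Ip Im),
      SignedMetricGraph.IsMaximalIsotropic M ↔
        ∃ A B, SignedMetricGraph.BoundaryCondition A B ∧ M = SignedMetricGraph.kerAB A B) ∧
    -- The self-adjoint extensions are exactly the operators given by admissible pairs.
    (∀ T : G.H →ₗ.[ℂ] G.H,
      (G.Tmin ≤ T ∧ IsSelfAdjoint T) ↔
        ∃ A B, SignedMetricGraph.BoundaryCondition A B ∧ T = G.opAB A B) := by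
  refine ⟨G.bijOn_opOf, SignedMetricGraph.isMaximalIsotropic_iff_exists_kerAB, fun T => ?_⟩
  constructor
  · intro hT
    obtain ⟨M, hM, rfl⟩ := G.bijOn_opOf.surjOn hT
    obtain ⟨A, B, hAB, rfl⟩ := (SignedMetricGraph.isMaximalIsotropic_iff_exists_kerAB M).1 hM
    exact ⟨A, B, hAB, (G.opAB_eq_opOf A B).symm⟩
  · rintro ⟨A, B, hAB, rfl⟩
    rw [G.opAB_eq_opOf]
    exact G.bijOn_opOf.mapsTo
      ((SignedMetricGraph.isMaximalIsotropic_iff_exists_kerAB _).2 ⟨A, B, hAB, rfl⟩)
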